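/- Let $F$ be a nonarchimedean local field of characteristic zero and odd residual characteristic, let $K$ be an algebraic closure of $F$, and let $n\ge 2$. Let $\mathbf G=\mathrm{GL}_{2n}$ and let $\theta$ be the involution $\theta(g)=\varepsilon^{-1}\,{}^t g^{-1}\varepsilon$ of $\mathbf G$, where $\varepsilon=\begin{pmatrix}0&J_n\\-J_n&0\end{pmatrix}$ and $J_n\in\mathrm{GL}_n(F)$ is the matrix with ones on the antidiagonal and zeros elsewhere. Algebraic $F$-subgroups of $\mathbf G$ are regarded as subgroups of $\mathrm{GL}_{2n}(K)$ defined over $F$. An $F$-torus $S\subset\mathbf G$ is called $(\theta,F)$-split if it is $F$-split and $\theta(s)=s^{-1}$ for all $s\in S$. A parabolic $F$-subgroup $P$ of $\mathbf G$ is called $\theta$-split if $\theta(P)$ is opposite to $P$, that is, if $P\cap\theta(P)$ is a Levi subgroup of both $P$ and $\theta(P)$. Let $A_0$ be the group of diagonal matrices in $\mathbf G$, and put $$S_0=\{\mathrm{diag}(a_1,\ldots,a_n,a_n,\ldots,a_1): a_i\ne 0\}.$$ Let $w_+$ be the permutation matrix of the permutation $2i-1\mapsto i$, $2i\mapsto 2n+1-i$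 $(1\le i\le n)$ of $\{1,\ldots,2n\}$ (so $w_+e_j=e_{w_+(j)}$), and let $P_0=w_+P_{(2,\ldots,2)}w_+^{-1}$, where $P_{(2,\ldots,2)}$ is the standard block upper triangular parabolic subgroup with $2\times 2$ diagonal blocks. Then: 1. $A_0$ is a maximal $F$-split torus of $\mathbf G$ and is $\theta$-stable, i.e. $\theta(A_0)=A_0$. 2. $S_0\subset A_0$, and $S_0$ is a maximal $(\theta,F)$-split torus of $\mathbf G$. 3. $P_0$ is a minimal $\theta$-split parabolic subgroup of $\mathbf G$, i.e. it is a $\theta$-split parabolic $F$-subgroup that properly contains no $\theta$-split parabolic $F$-subgroup. Moreover, the groups of $F$-points of $A_0$, $S_0$ and $P_0$ are the subgroups of $\mathrm{GL}_{2n}(F)$ given by the same formulas over $F$. -/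

import Mathlib

open Matrix Topology

noncomputable section

namespace SympSym

/-! ### Linear algebraic groups

Throughout, `K` is an algebraically closed extension of a perfect field `k`. A linear algebraic
group is identified with its group of `K`-points, a Zariski-closed subgroup of `GL m K`; it is
defined over `k` when it is cut out in `GL m K` by polynomials with coefficients in `k`. -/

section Algebraic

variable {m l : Type*} [Fintype m] [DecidableEq m] [Fintype l] [DecidableEq l]
variable {K : Type*} [Field K]

/-- The matrix entries of `g`, as a point of affine space. -/
def coords (g : GL m K) : m × m → K := fun ij => (g : Matrix m m K) ij.1 ij.2

/-- The `k`-Zariski topology on `GL m K`: the closed sets are the zero loci of ideals of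
polynomials with coefficients in `k` in the matrix entries. (The inverse of the determinant adds
no further closed sets, since denominators can be cleared.) -/
@[reducible]
def zariskiTopology (k : Type*) [Field k] (m : Type*) [Fintype m] [DecidableEq m]
    (K : Type*) [Field K] [Algebra k K] : TopologicalSpace (GL m K) :=
  TopologicalSpace.ofClosed
    {Z | ∃ I : Ideal (MvPolynomial (m × m) k), Z = coords ⁻¹' MvPolynomial.zeroLocus K I}
    ⟨⊤, by simp⟩
    (by
      intro A hA
      refine ⟨sSup {I | coords ⁻¹' MvPolynomial.zeroLocus K I ∈ A}, ?_⟩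
      apply Set.Subset.antisymm
      · intro g hg
        have key : sSup {I | coords ⁻¹' MvPolynomial.zeroLocus K I ∈ A} ≤
            MvPolynomial.vanishingIdeal k {coords g} := by
          refine sSup_le fun I hI p hp => ?_
          rw [MvPolynomial.mem_vanishingIdeal_singleton_iff]
          exact (Set.mem_sInter.1 hg _ hI) p hp
        intro p hp
        exact (MvPolynomial.mem_vanishingIdeal_singleton_iff _ _).1 (key hp)
      · intro g hg
        refine Set.mem_sInter.2 fun Z hZ => ?_
        obtain ⟨I, rfl⟩ := hA hZ
        exact MvPolynomial.zeroLocus_anti_mono (le_sSup hZ) hg)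
    (by
      rintro _ ⟨I, rfl⟩ _ ⟨J, rfl⟩
      refine ⟨I * J, ?_⟩
      apply Set.Subset.antisymm
      · rintro g (hg | hg)
        · exact MvPolynomial.zeroLocus_anti_mono (J := I) (I := I * J) Ideal.mul_le_left hg
        · exact MvPolynomial.zeroLocus_anti_mono (J := J) (I := I * J) Ideal.mul_le_right hg
      · intro g hg
        by_contra hcon
        simp only [Set.mem_union, Set.mem_preimage, MvPolynomial.mem_zeroLocus_iff, not_or,
          not_forall] at hcon
        obtain ⟨⟨p, hp, hp0⟩, ⟨q, hq, hq0⟩⟩ := hcon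
        have := hg (p * q) (Ideal.mul_mem_mul hp hq)
        rw [map_mul] at this
        exact (mul_ne_zero hp0 hq0) this)

/-- `H` is an algebraic `k`-subgroup of `GL m K`: it is Zariski-closed and defined over `k`. -/
def IsAlgSubgroup (k : Type*) [Field k] [Algebra k K] (H : Subgroup (GL m K)) : Prop :=
  IsClosed[zariskiTopology k m K] (H : Set (GL m K))

/-- `H` is connected in the Zariski topology of `GL m K`. -/
def IsZariskiConnected (H : Subgroup (GL m K)) : Prop :=
  @IsConnected _ (zariskiTopology K m K) (H : Set (GL m K))

/-- A map between subgroups of general linear groups is `k`-regular if each matrix entry of the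
image is given by a polynomial over `k` in the entries of `g` and in `(det g)⁻¹`. -/
def IsRegularMap (k : Type*) [Field k] [Algebra k K] {H : Subgroup (GL m K)}
    {H' : Subgroup (GL l K)} (φ : H → H') : Prop :=
  ∀ i j : l, ∃ (p : MvPolynomial (m × m) k) (d : ℕ), ∀ g : H,
    ((φ g : GL l K) : Matrix l l K) i j =
      MvPolynomial.aeval (coords (g : GL m K)) p *
        ((((g : GL m K) : Matrix m m K).det)⁻¹) ^ d

/-- The embedding of `(R^×)^m` in `GL m R` as diagonal matrices. -/
def diagHom (m : Type*) [Fintype m] [DecidableEq m] (R : Type*) [CommRing R] :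
    (m → Rˣ) →* GL m R :=
  (Units.map (Matrix.diagonalRingHom m R).toMonoidHom).comp
    (MulEquiv.piUnits (M := fun _ : m => R)).symm.toMonoidHom

/-- The group of invertible diagonal matrices. -/
def diagonalSubgroup (m : Type*) [Fintype m] [DecidableEq m] (R : Type*) [CommRing R] :
    Subgroup (GL m R) :=
  (diagHom m R).range

/-- `T` is a `k`-split torus: an algebraic `k`-group that is isomorphic over `k` to a product
`𝔾ₘ^r` of multiplicative groups (realized as the diagonal matrices of size `r`). -/
def IsSplitTorus (k : Type*) [Field k] [Algebra k K] (T : Subgroup (GL m K)) : Prop :=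
  IsAlgSubgroup k T ∧
    ∃ (r : ℕ) (e : T ≃* diagonalSubgroup (Fin r) K), IsRegularMap k e ∧ IsRegularMap k e.symm

/-- A Borel subgroup of `GL m K`: a maximal closed connected solvable subgroup. -/
def IsBorel (B : Subgroup (GL m K)) : Prop :=
  Maximal (fun B' : Subgroup (GL m K) =>
    IsAlgSubgroup K B' ∧ IsZariskiConnected B' ∧ Group.IsSolvable B') B

/-- `P` is a parabolic `k`-subgroup of `GL m K`: an algebraic `k`-subgroup containing a Borel
subgroup (which need not be defined over `k`). -/
def IsParabolic (k : Type*) [Field k] [Algebra k K] (P : Subgroup (GL m K)) : Prop :=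
  IsAlgSubgroup k P ∧ ∃ B : Subgroup (GL m K), IsBorel B ∧ B ≤ P

/-- The unipotent radical of `P`: the subgroup generated by all closed connected normal unipotent
subgroups of `P` (for closed `P` it is the largest such subgroup). -/
def unipotentRadical (P : Subgroup (GL m K)) : Subgroup (GL m K) :=
  sSup {U | U ≤ P ∧ IsAlgSubgroup K U ∧ IsZariskiConnected U ∧
    P ≤ Subgroup.normalizer (U : Set (GL m K)) ∧
    ∀ u ∈ U, IsNilpotent ((u : Matrix m m K) - 1)}

/-- `L` is a Levi subgroup of `P`: a closed subgroup such that `P` is the semidirect product of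
`L` and the unipotent radical of `P`. -/
def IsLevi (L P : Subgroup (GL m K)) : Prop :=
  IsAlgSubgroup K L ∧ L ⊓ unipotentRadical P = ⊥ ∧ L ⊔ unipotentRadical P = P

/-- Two parabolic subgroups are opposite if their intersection is a Levi subgroup of both. -/
def AreOpposite (P Q : Subgroup (GL m K)) : Prop :=
  IsLevi (P ⊓ Q) P ∧ IsLevi (P ⊓ Q) Q

/-- The group of `k`-points of a subgroup of `GL m K`. -/
def rationalPoints (k : Type*) [Field k] [Algebra k K] (H : Subgroup (GL m K)) :
    Subgroup (GL m k) :=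
  H.comap (GeneralLinearGroup.map (algebraMap k K))

/-! ### Notions relative to an involution `θ` -/

/-- `S` is a `(θ, k)`-split torus: a `k`-split torus with `θ s = s⁻¹` for all `s ∈ S`. -/
def IsThetaSplitTorus (k : Type*) [Field k] [Algebra k K] (θ : GL m K →* GL m K)
    (S : Subgroup (GL m K)) : Prop :=
  IsSplitTorus k S ∧ ∀ s ∈ S, θ s = s⁻¹

/-- `P` is a `θ`-split parabolic `k`-subgroup: a parabolic `k`-subgroup opposite to `θ(P)`. -/
def IsThetaSplitParabolic (k : Type*) [Field k] [Algebra k K] (θ : GL m K →* GL m K)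
    (P : Subgroup (GL m K)) : Prop :=
  IsParabolic k P ∧ AreOpposite P (P.map θ)

end Algebraic

/-! ### The symmetric space `Sp_{2n} \ GL_{2n}`

Rows and columns are indexed by `0, …, 2n - 1`; `Fin.rev i = 2n - 1 - i`. -/

section Concrete

variable (n : ℕ) (R : Type*) [CommRing R]

/-- The antidiagonal skew-symmetric matrix `ε = [[0, J], [-J, 0]]`, where `J` is the `n × n` matrix
with ones on the antidiagonal and zeros elsewhere. -/
def epsMatrix : Matrix (Fin (2 * n)) (Fin (2 * n)) R :=
  Matrix.of fun i j => if j = i.rev then (if (i : ℕ) < n then 1 else -1) else 0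

theorem epsMatrix_mul_transpose : epsMatrix n R * (epsMatrix n R)ᵀ = 1 := by
  ext i j
  simp only [epsMatrix, mul_apply, transpose_apply, of_apply, one_apply, ite_mul, zero_mul,
    Finset.sum_ite_eq', Finset.mem_univ, if_true]
  by_cases h : i = j
  · subst h
    by_cases h' : (i : ℕ) < n <;> simp [h']
  · have : i.rev ≠ j.rev := fun h' => h (Fin.rev_injective h')
    simp [h, this]

/-- `ε` as an element of `GL_{2n}`; its inverse is its transpose. -/
def eps : GL (Fin (2 * n)) R where
  val := epsMatrix n R
  inv := (epsMatrix n R)ᵀ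
  val_inv := epsMatrix_mul_transpose n R
  inv_val := mul_eq_one_comm.1 (epsMatrix_mul_transpose n R)

/-- The automorphism `g ↦ (ᵗg)⁻¹`. -/
def invTranspose (m : Type*) [Fintype m] [DecidableEq m] : GL m R →* GL m R where
  toFun g :=
    { val := ((g⁻¹ : GL m R) : Matrix m m R)ᵀ
      inv := (g : Matrix m m R)ᵀ
      val_inv := by rw [← transpose_mul, Units.mul_inv, transpose_one]
      inv_val := by rw [← transpose_mul, Units.inv_mul, transpose_one] }
  map_one' := by ext1; simp
  map_mul' g h := by ext1; simp [transpose_mul]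

/-- The involution `θ(g) = ε⁻¹ (ᵗg)⁻¹ ε` of `GL_{2n}`. -/
def theta : GL (Fin (2 * n)) R →* GL (Fin (2 * n)) R :=
  (MulAut.conj (eps n R)⁻¹).toMonoidHom.comp (invTranspose R (Fin (2 * n)))

/-- The diagonal torus `A₀` of `GL_{2n}`. -/
def A₀ : Subgroup (GL (Fin (2 * n)) R) := diagonalSubgroup (Fin (2 * n)) R

/-- The map `0, …, n-1, n, …, 2n-1 ↦ 0, …, n-1, n-1, …, 0`. -/
def fold (i : Fin (2 * n)) : Fin n :=
  ⟨min (i : ℕ) (2 * n - 1 - i), by have := i.isLt; omega⟩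

/-- The group `S₀` of matrices `diag(a₁, …, aₙ, aₙ, …, a₁)`. -/
def S₀ : Subgroup (GL (Fin (2 * n)) R) where
  carrier := {g | ∃ a : Fin n → Rˣ, g = diagHom (Fin (2 * n)) R fun i => a (fold n i)}
  one_mem' := ⟨1, (map_one _).symm⟩
  mul_mem' := by
    rintro _ _ ⟨a, rfl⟩ ⟨b, rfl⟩
    exact ⟨a * b, (map_mul _ _ _).symm⟩
  inv_mem' := by
    rintro _ ⟨a, rfl⟩
    exact ⟨a⁻¹, (map_inv _ _).symm⟩

/-- The permutation of `0, …, 2n - 1` with `2i ↦ i` and `2i + 1 ↦ 2n - 1 - i` for `0 ≤ i < n`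
(in one-based indexing: `2i - 1 ↦ i` and `2i ↦ 2n + 1 - i` for `1 ≤ i ≤ n`). -/
def wPerm : Equiv.Perm (Fin (2 * n)) where
  toFun j := if (j : ℕ) % 2 = 0 then ⟨j / 2, by omega⟩ else ⟨2 * n - 1 - j / 2, by omega⟩
  invFun i := if h : (i : ℕ) < n then ⟨2 * i, by omega⟩ else ⟨2 * (2 * n - 1 - i) + 1, by omega⟩
  left_inv j := by
    have hj := j.isLt
    ext
    by_cases h : (j : ℕ) % 2 = 0
    · have h1 : (j : ℕ) / 2 < n := by omega
      simp only [h, if_true, h1, dif_pos]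
      omega
    · have h1 : ¬ (2 * n - 1 - (j : ℕ) / 2 < n) := by omega
      simp only [h, if_false, h1, dif_neg, not_false_eq_true]
      omega
  right_inv i := by
    have hi := i.isLt
    ext
    by_cases h : (i : ℕ) < n
    · simp [h]
    · have h1 : ¬ ((2 * (2 * n - 1 - (i : ℕ)) + 1) % 2 = 0) := by omega
      simp only [h, dif_neg, not_false_eq_true, h1, if_false]
      omega

/-- The matrix of a permutation `σ`, sending the basis vector `e_j` to `e_{σ j}`. -/
def permGL (m : Type*) [Fintype m] [DecidableEq m] (σ : Equiv.Perm m) : GL m R where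
  val := Matrix.of fun i j => if i = σ j then 1 else 0
  inv := Matrix.of fun i j => if j = σ i then 1 else 0
  val_inv := by
    ext i j
    simp only [mul_apply, of_apply, one_apply, ite_mul, one_mul, zero_mul]
    rw [Finset.sum_eq_single (σ.symm i)]
    · simp [eq_comm]
    · intro b _ hb
      have : i ≠ σ b := fun h => hb (by simp [h])
      simp [this]
    · simp
  inv_val := by
    ext i j
    simp [mul_apply, of_apply, one_apply, eq_comm]

/-- The permutation matrix `w₊`. -/
def wPlus : GL (Fin (2 * n)) R := permGL R (Fin (2 * n)) (wPerm n)

/-- The standard block upper triangular subgroup `P_{(2,…,2)}` of `GL_{2n}`: the index `i` lies in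
the block `⌊i / 2⌋`, and entries strictly below the block diagonal vanish. -/
def P₂ : Subgroup (GL (Fin (2 * n)) R) where
  carrier := {g | (g : Matrix (Fin (2 * n)) (Fin (2 * n)) R).BlockTriangular
    fun i => (i : ℕ) / 2}
  one_mem' := blockTriangular_one
  mul_mem' hg hh := hg.mul hh
  inv_mem' := by
    intro g hg
    have hg' : (g : Matrix (Fin (2 * n)) (Fin (2 * n)) R).BlockTriangular
      fun i => (i : ℕ) / 2 := hg
    let _ : Invertible (g : Matrix (Fin (2 * n)) (Fin (2 * n)) R) := g.isUnit.invertible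
    have := blockTriangular_inv_of_blockTriangular hg'
    rwa [← coe_units_inv] at this

/-- The conjugate `P₀ = w₊ P_{(2,…,2)} w₊⁻¹`. -/
def P₀ : Subgroup (GL (Fin (2 * n)) R) :=
  (P₂ n R).map (MulAut.conj (wPlus n R)).toMonoidHom

end Concrete

end SympSym

end

open SympSym ValuativeRel

/-! The tori are controlled by centralizers. Split tori are commutative, so a split torus containing
`A₀` commutes with all diagonal matrices and is diagonal; one containing `S₀` is block diagonal for
the pairs {i, `i.rev`}. On such a 2 × 2 block θ is g ↦ g / det g, so θ(g) = g⁻¹ forces g to equal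
its adjugate, that is, to be scalar (`mem_S₀_of_theta_eq_inv`).

`P₀` is the stabilizer of the chain E_k spanned by the e_i with `fold n i` < k, whose graded pieces
are planes. Since θ reverses the order of the blocks, P₀ ∩ θ(P₀) is the block diagonal subgroup, a
Levi subgroup of both (`isLevi_blockDiagonal`).

For minimality let Q ≤ P₀ be θ-split parabolic. By Lie–Kolchin (`exists_fullFlag_of_isSolvable`) Q
contains the stabilizer of a full flag W. The subspaces fixed by that stabilizer are exactly the
members of W, so E_k = W_{2k}, and W adds one line in each plane E_{k+1}/E_k. Two cases arise. If Q
preserves the line in some plane, its unipotent radical contains a block diagonal transvection τ ≠ 1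
along that line (`exists_unipotentRadical_blockDiagonal`). As θ(τ) differs from τ by an element of
S₀ ≤ Q, also τ ∈ θ(Q) (`mem_map_theta_of_blockDiagonal`). But Q ∩ θ(Q) is a Levi subgroup of Q and
meets the radical trivially, a contradiction. Otherwise Q moves the line in every plane. Conjugating
transvections of the flag stabilizer then allows the lines to be adjusted plane by plane inside Q,
which gives Q = P₀ (`stabChain_foldChain_le_of_moves`). -/

set_option linter.unusedSectionVars false

open scoped commutatorElement

namespace SympSym

/-! ### Zariski topology: regular maps and connectedness. -/

section Zariski

variable {m : Type*} [Fintype m] [DecidableEq m] {K : Type*} [Field K]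

theorem isClosed_zariski_iff (k : Type*) [Field k] [Algebra k K] {Z : Set (GL m K)} :
    IsClosed[zariskiTopology k m K] Z ↔
      ∃ I : Ideal (MvPolynomial (m × m) k), Z = coords ⁻¹' MvPolynomial.zeroLocus K I := by
  rw [← @isOpen_compl_iff _ _ (zariskiTopology k m K)]
  change Zᶜᶜ ∈ {Z | ∃ I : Ideal (MvPolynomial (m × m) k),
    Z = coords ⁻¹' MvPolynomial.zeroLocus K I} ↔ _
  rw [compl_compl]
  rfl

theorem isClosed_setOf_aeval_eq_zero (k : Type*) [Field k] [Algebra k K]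
    (S : Set (MvPolynomial (m × m) k)) :
    IsClosed[zariskiTopology k m K]
      {g : GL m K | ∀ p ∈ S, MvPolynomial.aeval (coords g) p = 0} := by
  rw [isClosed_zariski_iff]
  refine ⟨Ideal.span S, ?_⟩
  rw [MvPolynomial.zeroLocus_span]
  rfl

/-- The Zariski topology over `K` itself. -/
@[reducible]
def geometricTopology (m : Type*) [Fintype m] [DecidableEq m] (K : Type*) [Field K] :
    TopologicalSpace (GL m K) :=
  zariskiTopology K m K

attribute [local instance] geometricTopology

theorem isClosed_setOf_linear_eq (ψ : Matrix m m K →ₗ[K] K) (c : K) :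
    IsClosed {g : GL m K | ψ g.1 = c} := by
  have := isClosed_setOf_aeval_eq_zero (m := m) (K := K) K
    {∑ ij : m × m, MvPolynomial.C (ψ (Matrix.single ij.1 ij.2 1)) * MvPolynomial.X ij -
      MvPolynomial.C c}
  convert! this using 1
  ext g
  simp only [Set.mem_ofPred_eq]
  simp only [Set.mem_singleton_iff, forall_eq, map_sub, map_sum, map_mul,
    MvPolynomial.aeval_X, MvPolynomial.algHom_C, Algebra.algebraMap_self, RingHom.id_apply,
    sub_eq_zero]
  have h : ψ g.1 = ∑ ij : m × m, ψ (Matrix.single ij.1 ij.2 1) * coords g ij := by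
    conv_lhs => rw [Matrix.matrix_eq_sum_single g.1]
    rw [map_sum, Fintype.sum_prod_type]
    refine Finset.sum_congr rfl fun i _ => ?_
    rw [map_sum]
    refine Finset.sum_congr rfl fun j _ => ?_
    have : Matrix.single i j (g.1 i j) = g.1 i j • Matrix.single i j (1 : K) := by
      rw [Matrix.smul_single, smul_eq_mul, mul_one]
    rw [this, map_smul, smul_eq_mul, mul_comm]
    rfl
  rw [h]

/-- A subspace is the common kernel of the functionals that annihilate it, so membership amounts to
linear equations. -/
theorem isClosed_setOf_linear_mem {V : Type*} [AddCommGroup V] [Module K V]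
    (T : Matrix m m K →ₗ[K] V) (w : V) (X : Submodule K V) :
    IsClosed {g : GL m K | T g.1 - w ∈ X} := by
  have : {g : GL m K | T g.1 - w ∈ X} =
      ⋂ φ ∈ X.dualAnnihilator, {g : GL m K | (φ ∘ₗ T) g.1 = φ w} := by
    ext g
    simp only [Set.mem_ofPred_eq, Set.mem_iInter, LinearMap.comp_apply]
    rw [← Subspace.forall_mem_dualAnnihilator_apply_eq_zero_iff]
    simp only [map_sub, sub_eq_zero]
  rw [this]
  exact isClosed_biInter fun φ _ => isClosed_setOf_linear_eq _ _

/-- Functions on `GL m K` that become polynomial after multiplication by a power of the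
determinant. -/
def IsRegularFun (f : GL m K → K) : Prop :=
  ∃ (q : MvPolynomial (m × m) K) (N : ℕ), ∀ g : GL m K,
    f g * g.1.det ^ N = MvPolynomial.aeval (coords g) q

/-- The determinant as a polynomial in the matrix entries. -/
noncomputable def detPoly (m : Type*) [Fintype m] [DecidableEq m] (K : Type*) [Field K] :
    MvPolynomial (m × m) K :=
  (Matrix.of fun i j : m => (MvPolynomial.X (i, j) : MvPolynomial (m × m) K)).det

theorem aeval_detPoly (g : GL m K) : MvPolynomial.aeval (coords g) (detPoly m K) = g.1.det := by
  rw [detPoly, AlgHom.map_det]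
  congr 1
  ext i j
  simp [coords]

theorem IsRegularFun.const (c : K) : IsRegularFun (fun _ : GL m K => c) :=
  ⟨MvPolynomial.C c, 0, fun g => by simp⟩

theorem IsRegularFun.entry (i j : m) : IsRegularFun (fun g : GL m K => g.1 i j) :=
  ⟨MvPolynomial.X (i, j), 0, fun g => by simp [coords]⟩

theorem IsRegularFun.add {f f' : GL m K → K} (hf : IsRegularFun f) (hf' : IsRegularFun f') :
    IsRegularFun (fun g => f g + f' g) := by
  obtain ⟨q, N, h⟩ := hf
  obtain ⟨q', N', h'⟩ := hf'
  refine ⟨q * detPoly m K ^ N' + q' * detPoly m K ^ N, N + N', fun g => ?_⟩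
  rw [map_add, map_mul, map_mul, map_pow, map_pow, aeval_detPoly, ← h, ← h']
  ring

theorem IsRegularFun.mul {f f' : GL m K → K} (hf : IsRegularFun f) (hf' : IsRegularFun f') :
    IsRegularFun (fun g => f g * f' g) := by
  obtain ⟨q, N, h⟩ := hf
  obtain ⟨q', N', h'⟩ := hf'
  refine ⟨q * q', N + N', fun g => ?_⟩
  rw [map_mul, ← h, ← h']
  ring

theorem IsRegularFun.sum {ι : Type*} (s : Finset ι) {f : ι → GL m K → K}
    (hf : ∀ i ∈ s, IsRegularFun (f i)) : IsRegularFun (fun g => ∑ i ∈ s, f i g) := by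
  classical
  induction s using Finset.induction_on with
  | empty => simpa using IsRegularFun.const (m := m) (0 : K)
  | insert a s ha ih =>
    simp only [Finset.sum_insert ha]
    exact (hf a (by simp)).add (ih fun i hi => hf i (by simp [hi]))

/-- Cramer's rule: one factor of the determinant turns the inverse into the adjugate. -/
theorem IsRegularFun.inv_entry (i j : m) : IsRegularFun (fun g : GL m K => (g⁻¹ : GL m K).1 i j) := by
  refine ⟨(Matrix.of fun i j : m =>
    (MvPolynomial.X (i, j) : MvPolynomial (m × m) K)).adjugate i j, 1, fun g => ?_⟩
  have h1 : MvPolynomial.aeval (coords g) ((Matrix.of fun i j : m =>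
      (MvPolynomial.X (i, j) : MvPolynomial (m × m) K)).adjugate i j) = g.1.adjugate i j := by
    have := congrFun₂ (AlgHom.map_adjugate (MvPolynomial.aeval (coords g))
      (Matrix.of fun i j : m => (MvPolynomial.X (i, j) : MvPolynomial (m × m) K))) i j
    rw [AlgHom.mapMatrix_apply, Matrix.map_apply] at this
    rw [this]
    congr 2
    ext i j
    simp [coords]
  beta_reduce
  rw [h1, pow_one, Matrix.coe_units_inv, Matrix.inv_def, Matrix.smul_apply, smul_eq_mul,
    mul_right_comm, Ring.inverse_mul_cancel _ ((Matrix.isUnit_iff_isUnit_det _).1 g.isUnit),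
    one_mul]

/-- A polynomial equation pulls back to a regular function; multiplying by a power of the
determinant, which never vanishes on the group, makes it polynomial with the same zeros. -/
theorem continuous_of_isRegularFun {φ : GL m K → GL m K}
    (h : ∀ i j, IsRegularFun fun g => (φ g).1 i j) : Continuous φ := by
  have key (p : MvPolynomial (m × m) K) :
      IsRegularFun fun g => MvPolynomial.aeval (coords (φ g)) p := by
    induction p using MvPolynomial.induction_on with
    | C a => simpa using IsRegularFun.const a
    | add p q hp hq => simpa using hp.add hq
    | mul_X p ij hp => simpa [coords] using hp.mul (h ij.1 ij.2)
  refine continuous_iff_isClosed.2 fun Z hZ => ?_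
  obtain ⟨I, rfl⟩ := (isClosed_zariski_iff K).1 hZ
  choose q N hq using key
  convert! isClosed_setOf_aeval_eq_zero (m := m) (K := K) K (q '' I) using 1
  ext g
  simp only [Set.mem_preimage, MvPolynomial.mem_zeroLocus_iff, Set.mem_ofPred_eq,
    Set.forall_mem_image, ← hq]
  have hdet : g.1.det ≠ 0 := ((Matrix.isUnit_iff_isUnit_det _).1 g.isUnit).ne_zero
  simp [hdet]

theorem continuous_mul_left_GL (a : GL m K) : Continuous fun g : GL m K => a * g := by
  refine continuous_of_isRegularFun fun i j => ?_
  simp only [Units.val_mul, Matrix.mul_apply]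
  exact IsRegularFun.sum _ fun l _ => (IsRegularFun.const _).mul (IsRegularFun.entry _ _)

theorem continuous_commutator_GL (h : GL m K) : Continuous fun g : GL m K => ⁅g, h⁆ := by
  refine continuous_of_isRegularFun fun i j => ?_
  simp only [commutatorElement_def, Units.val_mul, Matrix.mul_apply]
  exact IsRegularFun.sum _ fun l _ => (IsRegularFun.sum _ fun l _ => (IsRegularFun.sum _ fun l _ =>
    (IsRegularFun.entry _ _).mul (IsRegularFun.const _)).mul
      (IsRegularFun.inv_entry _ _)).mul (IsRegularFun.const _)

/-- The connected component of 1 in the commutator group is a subgroup. It contains every ⁅g, h⁆,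
because for fixed h these form a connected image of H passing through ⁅1, h⁆ = 1. -/
theorem isConnected_commutator {H : Subgroup (GL m K)} (hH : IsZariskiConnected H) :
    IsZariskiConnected ⁅H, H⁆ := by
  have hH' : IsConnected (H : Set (GL m K)) := hH
  set D : Subgroup (GL m K) := ⁅H, H⁆
  set C := connectedComponentIn (D : Set (GL m K)) 1
  have h1D : (1 : GL m K) ∈ (D : Set (GL m K)) := D.one_mem
  have h1 : (1 : GL m K) ∈ C := mem_connectedComponentIn h1D
  have hC : IsPreconnected C := isPreconnected_connectedComponentIn
  have hCD : C ⊆ D := connectedComponentIn_subset _ _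
  -- Continuity of left translations suffices: if aC meets the component C, then aC lies in C.
  have hmul {a b : GL m K} (haD : a ∈ D) (hb : b ∈ C) (hab : a * b ∈ C) {x : GL m K}
      (hx : x ∈ C) : a * x ∈ C := by
    have h2 : IsPreconnected ((fun g => a * g) '' C) :=
      hC.image _ (continuous_mul_left_GL a).continuousOn
    have h3 : (fun g => a * g) '' C ⊆ D := by
      rintro _ ⟨y, hy, rfl⟩
      exact D.mul_mem haD (hCD hy)
    have h4 := h2.subset_connectedComponentIn ⟨b, hb, rfl⟩ h3
    have h5 : connectedComponentIn (D : Set (GL m K)) (a * b) = C :=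
      (connectedComponentIn_eq hab).symm
    exact h5 ▸ h4 ⟨x, hx, rfl⟩
  let C' : Subgroup (GL m K) :=
    { carrier := C
      one_mem' := h1
      mul_mem' := fun {a b} ha hb => hmul (hCD ha) h1 (by simpa using ha) hb
      inv_mem' := fun {a} ha => by
        simpa using hmul (D.inv_mem (hCD ha)) ha (by simpa using h1) h1 }
  have hDC : D ≤ C' := by
    refine Subgroup.commutator_le.2 fun g hg h hh => ?_
    have h2 : IsPreconnected ((fun g => ⁅g, h⁆) '' (H : Set (GL m K))) :=
      hH'.2.image _ (continuous_commutator_GL h).continuousOn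
    have h3 : (fun g => ⁅g, h⁆) '' (H : Set (GL m K)) ⊆ D := by
      rintro _ ⟨y, hy, rfl⟩
      exact Subgroup.commutator_mem_commutator hy hh
    exact h2.subset_connectedComponentIn ⟨1, H.one_mem, by simp⟩ h3 ⟨g, hg, rfl⟩
  have : C = D := Set.Subset.antisymm hCD hDC
  change IsConnected (D : Set (GL m K))
  rw [← this]
  exact ⟨⟨1, h1⟩, hC⟩

theorem _root_.IsPreconnected.subset_of_finite_closed_cover {X ι : Type*} [TopologicalSpace X]
    {S : Set X} (hS : IsPreconnected S) {s : Set ι} (hs : s.Finite) {Z : ι → Set X}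
    (hZ : ∀ i, IsClosed (Z i)) (hcov : ∀ x ∈ S, ∃ i ∈ s, x ∈ Z i)
    (hdis : ∀ x ∈ S, ∀ i j, x ∈ Z i → x ∈ Z j → i = j) {x : X} (hx : x ∈ S) {i : ι}
    (hi : x ∈ Z i) : S ⊆ Z i := by
  intro y hy
  by_contra hyi
  have hc : IsClosed (⋃ j ∈ s \ {i}, Z j) :=
    hs.sdiff.isClosed_biUnion fun j _ => hZ j
  obtain ⟨z, hz, hz1, hz2⟩ := isPreconnected_closed_iff.1 hS _ _ (hZ i) hc (by
    intro z hz
    obtain ⟨j, hj, hzj⟩ := hcov z hz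
    by_cases hji : j = i
    · exact Or.inl (hji ▸ hzj)
    · exact Or.inr (Set.mem_biUnion (show j ∈ s \ {i} from ⟨hj, hji⟩) hzj)) ⟨x, hx, hi⟩ (by
    obtain ⟨j, hj, hzj⟩ := hcov y hy
    exact ⟨y, hy, Set.mem_biUnion (show j ∈ s \ {i} from ⟨hj, fun h => hyi (h ▸ hzj)⟩) hzj⟩)
  obtain ⟨j, hj, hzj⟩ := Set.mem_iUnion₂.1 hz2
  exact hj.2 (hdis z hz j i hzj hz1)

/-- The invertible points of the line through 1 and g are irreducible: a polynomial vanishing at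
infinitely many of them vanishes on the whole line. Hence each g is joined to 1 inside H. -/
theorem isZariskiConnected_of_star [Infinite K] (H : Subgroup (GL m K))
    (h : ∀ g ∈ H, ∀ (t : K) (g' : GL m K), g'.1 = 1 + t • (g.1 - 1) → g' ∈ H) :
    IsZariskiConnected H := by
  refine ⟨⟨1, H.one_mem⟩, isPreconnected_of_forall 1 fun g hg => ?_⟩
  set A := g.1 - 1
  refine ⟨{g' | ∃ t : K, g'.1 = 1 + t • A}, ?_, ⟨0, by simp⟩, ⟨1, by simp [A]⟩, ?_⟩
  · rintro g' ⟨t, ht⟩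
    exact h g hg t g' ht
  set L : Set (GL m K) := {g' | ∃ t : K, g'.1 = 1 + t • A}
  have key (Z : Set (GL m K)) (hZ : IsClosed Z)
      (hinf : {t : K | ∃ g' ∈ Z, g'.1 = 1 + t • A}.Infinite) : L ⊆ Z := by
    obtain ⟨I, rfl⟩ := (isClosed_zariski_iff K).1 hZ
    rintro g' ⟨t, ht⟩ p hp
    let P : Polynomial K := MvPolynomial.aeval (fun ij : m × m =>
      Polynomial.C ((1 : Matrix m m K) ij.1 ij.2) + Polynomial.X * Polynomial.C (A ij.1 ij.2)) p
    have hP (s : K) (g'' : GL m K) (hs : g''.1 = 1 + s • A) :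
        P.eval s = MvPolynomial.aeval (coords g'') p := by
      rw [← Polynomial.coe_aeval_eq_eval, MvPolynomial.aeval_def, ← AlgHom.comp_apply,
        MvPolynomial.comp_aeval, MvPolynomial.aeval_def]
      congr 2
      ext ij
      simp [coords, hs]
      exact mul_comm _ _
    have hP0 : P = 0 := by
      refine Polynomial.eq_zero_of_infinite_isRoot P (hinf.mono ?_)
      rintro s ⟨g'', hg'', hs⟩
      change P.eval s = 0
      rw [hP s g'' hs]
      exact hg'' p hp
    rw [← hP t g' ht, hP0, Polynomial.eval_zero]
  have hunit : {t : K | ∃ g' : GL m K, g'.1 = 1 + t • A}.Infinite := by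
    let P : Polynomial K := (Matrix.of fun i j : m =>
      Polynomial.C ((1 : Matrix m m K) i j) + Polynomial.X * Polynomial.C (A i j)).det
    have hP (s : K) : P.eval s = (1 + s • A).det := by
      rw [← Polynomial.coe_evalRingHom, RingHom.map_det]
      congr 1
      ext i j
      simp
      exact mul_comm _ _
    have hP0 : P ≠ 0 := by
      intro h0
      have := hP 0
      simp [h0] at this
    have hfin : {t : K | P.IsRoot t}.Finite := Polynomial.finite_setOfPred_isRoot hP0
    refine hfin.infinite_compl.mono fun t ht => ?_
    have hdet : (1 + t • A).det ≠ 0 := by rw [← hP]; exact ht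
    exact ⟨Matrix.GeneralLinearGroup.mkOfDetNeZero _ hdet, rfl⟩
  refine isPreconnected_closed_iff.2 fun Z₁ Z₂ hZ₁ hZ₂ hcov h₁ h₂ => ?_
  have hor : {t : K | ∃ g' ∈ Z₁, g'.1 = 1 + t • A}.Infinite ∨
      {t : K | ∃ g' ∈ Z₂, g'.1 = 1 + t • A}.Infinite := by
    rw [← Set.infinite_union]
    refine hunit.mono ?_
    rintro t ⟨g', hg'⟩
    rcases hcov ⟨t, hg'⟩ with h | h
    exacts [Or.inl ⟨g', h, hg'⟩, Or.inr ⟨g', h, hg'⟩]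
  rcases hor with h | h
  · obtain ⟨x, hx, hx2⟩ := h₂
    exact ⟨x, hx, key Z₁ hZ₁ h hx, hx2⟩
  · obtain ⟨x, hx, hx1⟩ := h₁
    exact ⟨x, hx, hx1, key Z₂ hZ₂ h hx⟩

end Zariski

/-! ### Stabilizers of chains of subspaces and full flags. -/

section Chains

attribute [local instance] geometricTopology

variable {m : Type*} [Fintype m] [DecidableEq m] {K : Type*} [Field K]

theorem mul_mulVec (g h : GL m K) (v : m → K) :
    (g * h).1 *ᵥ v = g.1 *ᵥ (h.1 *ᵥ v) := by
  rw [Units.val_mul, Matrix.mulVec_mulVec]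

theorem inv_mulVec_mulVec (g : GL m K) (v : m → K) : (g⁻¹).1 *ᵥ (g.1 *ᵥ v) = v := by
  rw [← mul_mulVec, inv_mul_cancel, Units.val_one, Matrix.one_mulVec]

theorem mulVec_inv_mulVec (g : GL m K) (v : m → K) : g.1 *ᵥ ((g⁻¹).1 *ᵥ v) = v := by
  rw [← mul_mulVec, mul_inv_cancel, Units.val_one, Matrix.one_mulVec]

/-- An injective endomorphism of a finite-dimensional space is surjective, so g X ⊆ X already gives
g X = X. -/
theorem inv_mulVec_mem {g : GL m K} {X : Submodule K (m → K)} (h : ∀ v ∈ X, g.1 *ᵥ v ∈ X)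
    {v : m → K} (hv : v ∈ X) : (g⁻¹).1 *ᵥ v ∈ X := by
  let f : X →ₗ[K] X := (Matrix.mulVecLin g.1).restrict h
  have hinj : Function.Injective f := by
    intro a b hab
    have h1 : g.1 *ᵥ (a : m → K) = g.1 *ᵥ (b : m → K) := congrArg Subtype.val hab
    have h2 := congrArg (fun w => (g⁻¹).1 *ᵥ w) h1
    simp only [inv_mulVec_mulVec] at h2
    exact Subtype.ext h2
  obtain ⟨w, hw⟩ := LinearMap.injective_iff_surjective.1 hinj ⟨v, hv⟩
  have h1 : g.1 *ᵥ (w : m → K) = v := congrArg Subtype.val hw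
  rw [← h1, inv_mulVec_mulVec]
  exact w.2

theorem isClosed_setOf_mulVec_mem (A : Matrix m m K) (v w : m → K) (X : Submodule K (m → K)) :
    IsClosed {g : GL m K | A *ᵥ (g.1 *ᵥ v) - w ∈ X} :=
  isClosed_setOf_linear_mem
    (Matrix.mulVecLin A ∘ₗ LinearMap.applyₗ v ∘ₗ (Matrix.toLin' (R := K)).toLinearMap) w X

/-- The subgroup of `GL m K` preserving each member of a sequence of subspaces. -/
def stabChain (C : ℕ → Submodule K (m → K)) : Subgroup (GL m K) where
  carrier := {g | ∀ k, ∀ v ∈ C k, g.1 *ᵥ v ∈ C k}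
  one_mem' := fun k v hv => by simpa using hv
  mul_mem' := fun {g h} hg hh k v hv => by
    rw [mul_mulVec]
    exact hg k _ (hh k v hv)
  inv_mem' := fun {g} hg k v hv => inv_mulVec_mem (hg k) hv

theorem mem_stabChain {C : ℕ → Submodule K (m → K)} {g : GL m K} :
    g ∈ stabChain C ↔ ∀ k, ∀ v ∈ C k, g.1 *ᵥ v ∈ C k :=
  Iff.rfl

/-- The subgroup of `GL m K` preserving each member of a sequence of subspaces and moving
vectors of `C (j + r)` only by vectors of `C j`. -/
def depthChain (r : ℕ) (C : ℕ → Submodule K (m → K)) : Subgroup (GL m K) where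
  carrier := {g | g ∈ stabChain C ∧ ∀ j, ∀ v ∈ C (j + r), g.1 *ᵥ v - v ∈ C j}
  one_mem' := ⟨one_mem _, fun j v _ => by simp⟩
  mul_mem' := fun {g h} hg hh => ⟨mul_mem hg.1 hh.1, fun j v hv => by
    rw [mul_mulVec]
    have h1 := add_mem (hg.1 j _ (hh.2 j v hv)) (hg.2 j v hv)
    rwa [Matrix.mulVec_sub, sub_add_sub_cancel] at h1⟩
  inv_mem' := fun {g} hg => ⟨inv_mem hg.1, fun j v hv => by
    have h1 := neg_mem (inv_mem hg.1 j _ (hg.2 j v hv))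
    rwa [Matrix.mulVec_sub, inv_mulVec_mulVec, neg_sub] at h1⟩

theorem mem_depthChain {r : ℕ} {C : ℕ → Submodule K (m → K)} {g : GL m K} :
    g ∈ depthChain r C ↔ g ∈ stabChain C ∧ ∀ j, ∀ v ∈ C (j + r), g.1 *ᵥ v - v ∈ C j :=
  Iff.rfl

theorem isAlgSubgroup_stabChain (C : ℕ → Submodule K (m → K)) :
    IsAlgSubgroup K (stabChain C) := by
  change IsClosed (stabChain C : Set (GL m K))
  have : (stabChain C : Set (GL m K)) =
      ⋂ k, ⋂ v ∈ C k, {g : GL m K | (1 : Matrix m m K) *ᵥ (g.1 *ᵥ v) - 0 ∈ C k} := by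
    ext g
    simp [mem_stabChain]
  rw [this]
  exact isClosed_iInter fun k => isClosed_biInter fun v _ => isClosed_setOf_mulVec_mem _ _ _ _

theorem isAlgSubgroup_depthChain (r : ℕ) (C : ℕ → Submodule K (m → K)) :
    IsAlgSubgroup K (depthChain r C) := by
  change IsClosed (depthChain r C : Set (GL m K))
  have : (depthChain r C : Set (GL m K)) = (stabChain C : Set (GL m K)) ∩
      ⋂ j, ⋂ v ∈ C (j + r), {g : GL m K | (1 : Matrix m m K) *ᵥ (g.1 *ᵥ v) - v ∈ C j} := by
    ext g
    simp [mem_depthChain]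
  rw [this]
  exact IsClosed.inter (isAlgSubgroup_stabChain C)
    (isClosed_iInter fun k => isClosed_biInter fun v _ => isClosed_setOf_mulVec_mem _ _ _ _)

theorem star_mulVec {g g' : GL m K} {t : K} (h : g'.1 = 1 + t • (g.1 - 1)) (v : m → K) :
    g'.1 *ᵥ v = v + t • (g.1 *ᵥ v - v) := by
  rw [h, Matrix.add_mulVec, Matrix.one_mulVec, Matrix.smul_mulVec, Matrix.sub_mulVec,
    Matrix.one_mulVec]

theorem isZariskiConnected_stabChain [Infinite K] (C : ℕ → Submodule K (m → K)) :
    IsZariskiConnected (stabChain C) := by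
  refine isZariskiConnected_of_star _ fun g hg t g' h k v hv => ?_
  rw [star_mulVec h]
  exact add_mem hv (Submodule.smul_mem _ _ (sub_mem (hg k v hv) hv))

theorem isZariskiConnected_depthChain [Infinite K] (r : ℕ) (C : ℕ → Submodule K (m → K)) :
    IsZariskiConnected (depthChain r C) := by
  refine isZariskiConnected_of_star _ fun g hg t g' h => ⟨fun k v hv => ?_, fun k v hv => ?_⟩
  · rw [star_mulVec h]
    exact add_mem hv (Submodule.smul_mem _ _ (sub_mem (hg.1 k v hv) hv))
  · rw [star_mulVec h, add_sub_cancel_left]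
    exact Submodule.smul_mem _ _ (hg.2 k v hv)

theorem isNilpotent_sub_one_of_mem_depthChain {C : ℕ → Submodule K (m → K)} {N : ℕ}
    (h0 : C 0 = ⊥) (hN : C N = ⊤) {g : GL m K} (hg : g ∈ depthChain 1 C) :
    IsNilpotent (g.1 - 1) := by
  refine ⟨N, ?_⟩
  have key (k : ℕ) : ∀ v ∈ C k, (g.1 - 1) ^ k *ᵥ v = 0 := by
    induction k with
    | zero =>
      intro v hv
      rw [h0, Submodule.mem_bot] at hv
      simp [hv]
    | succ k ih =>
      intro v hv
      rw [pow_succ, ← Matrix.mulVec_mulVec, Matrix.sub_mulVec, Matrix.one_mulVec]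
      exact ih _ (hg.2 k v hv)
  refine Matrix.ext_of_mulVec_single fun j => ?_
  rw [key N _ (by rw [hN]; trivial), Matrix.zero_mulVec]

theorem conj_mem_depthChain {r : ℕ} {C : ℕ → Submodule K (m → K)} {g u : GL m K}
    (hg : g ∈ stabChain C) (hu : u ∈ depthChain r C) : g * u * g⁻¹ ∈ depthChain r C := by
  refine ⟨mul_mem (mul_mem hg hu.1) (inv_mem hg), fun j v hv => ?_⟩
  rw [mul_mulVec, mul_mulVec]
  have h1 := hg j _ (hu.2 j _ (inv_mem hg _ v hv))
  rwa [Matrix.mulVec_sub, mulVec_inv_mulVec] at h1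

theorem le_normalizer_of_conj_mem {G : Type*} [Group G] {P U : Subgroup G}
    (h : ∀ g ∈ P, ∀ u ∈ U, g * u * g⁻¹ ∈ U) : P ≤ Subgroup.normalizer (U : Set G) := by
  intro g hg
  refine Subgroup.mem_normalizer_iff.2 fun u => ⟨h g hg u, fun hu => ?_⟩
  simpa [mul_assoc] using h g⁻¹ (inv_mem hg) _ hu

/-- A full flag of subspaces of `K^m`. -/
structure IsFullFlag (W : ℕ → Submodule K (m → K)) : Prop where
  mono : Monotone W
  zero : W 0 = ⊥
  top : W (Fintype.card m) = ⊤
  step : ∀ k, ∃ e ∈ W (k + 1), W (k + 1) ≤ W k ⊔ Submodule.span K {e}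

theorem IsFullFlag.finrank_le {W : ℕ → Submodule K (m → K)} (hW : IsFullFlag W) (i k : ℕ) :
    Module.finrank K (W (i + k)) ≤ Module.finrank K (W i) + k := by
  induction k with
  | zero => simp
  | succ k ih =>
    obtain ⟨e, -, he⟩ := hW.step (i + k)
    have h1 := (Submodule.finrank_mono he).trans (Submodule.finrank_add_le_finrank_add_finrank _ _)
    have h2 : Module.finrank K (Submodule.span K {e}) ≤ 1 :=
      (finrank_span_le_card ({e} : Set (m → K))).trans (by simp)
    rw [← add_assoc]
    omega

/-- Each step gains at most one dimension, and `Fintype.card m` steps must exhaust the space, so no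
step is lost. -/
theorem IsFullFlag.finrank_eq {W : ℕ → Submodule K (m → K)} (hW : IsFullFlag W) {k : ℕ}
    (hk : k ≤ Fintype.card m) : Module.finrank K (W k) = k := by
  have h1 := hW.finrank_le 0 k
  have h2 := hW.finrank_le k (Fintype.card m - k)
  rw [Nat.add_sub_cancel' hk, hW.top, finrank_top, Module.finrank_fintype_fun_eq_card] at h2
  rw [hW.zero, finrank_bot, Nat.zero_add] at h1
  omega

/-- It suffices to treat gh − hg, since ⁅g, h⁆ − 1 = (gh − hg)(hg)⁻¹. For r > 0 one writes gh − hg =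
(g − 1)(h − 1) − (h − 1)(g − 1), and each product descends at least r + 1 steps. -/
theorem commutator_depthChain_le {W : ℕ → Submodule K (m → K)} (hW : IsFullFlag W) (r : ℕ) :
    ⁅depthChain r W, depthChain r W⁆ ≤ depthChain (r + 1) W := by
  refine Subgroup.commutator_le.2 fun g hg h hh => ?_
  have hst : ⁅g, h⁆ ∈ stabChain W := by
    rw [commutatorElement_def]
    exact mul_mem (mul_mem (mul_mem hg.1 hh.1) (inv_mem hg.1)) (inv_mem hh.1)
  refine ⟨hst, fun j w hw => ?_⟩
  have key : ∀ v ∈ W (j + (r + 1)), g.1 *ᵥ (h.1 *ᵥ v) - h.1 *ᵥ (g.1 *ᵥ v) ∈ W j := by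
    intro v hv
    rcases Nat.eq_zero_or_pos r with rfl | hr
    -- For r = 0 both elements act by scalars on the quotient W (j + 1) / W j, of dimension at most
    -- one, so they commute there.
    · obtain ⟨e, he, hle⟩ := hW.step j
      have hcoef (f : GL m K) (hf : f ∈ stabChain W) : ∃ a : K, f.1 *ᵥ e - a • e ∈ W j := by
        obtain ⟨w, hw, z, hz, hwz⟩ := Submodule.mem_sup.1 (hle (hf _ e he))
        obtain ⟨a, rfl⟩ := Submodule.mem_span_singleton.1 hz
        exact ⟨a, by rwa [← hwz, add_sub_cancel_right]⟩
      obtain ⟨w, hw, z, hz, rfl⟩ := Submodule.mem_sup.1 (hle hv)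
      obtain ⟨a, rfl⟩ := Submodule.mem_span_singleton.1 hz
      obtain ⟨b, hb⟩ := hcoef g hg.1
      obtain ⟨c, hc⟩ := hcoef h hh.1
      have h1 : g.1 *ᵥ (h.1 *ᵥ (w + a • e)) - h.1 *ᵥ (g.1 *ᵥ (w + a • e)) =
          (g.1 *ᵥ (h.1 *ᵥ w) - h.1 *ᵥ (g.1 *ᵥ w)) +
          a • ((g.1 *ᵥ (h.1 *ᵥ e - c • e) + c • (g.1 *ᵥ e - b • e)) -
            (h.1 *ᵥ (g.1 *ᵥ e - b • e) + b • (h.1 *ᵥ e - c • e))) := by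
        simp only [Matrix.mulVec_add, Matrix.mulVec_sub, Matrix.mulVec_smul]
        module
      rw [h1]
      exact add_mem (sub_mem (hg.1 _ _ (hh.1 _ _ hw)) (hh.1 _ _ (hg.1 _ _ hw)))
        (Submodule.smul_mem _ _ (sub_mem
          (add_mem (hg.1 _ _ hc) (Submodule.smul_mem _ _ hb))
          (add_mem (hh.1 _ _ hb) (Submodule.smul_mem _ _ hc))))
    · have h2 (f f' : GL m K) (hf : f ∈ depthChain r W) (hf' : f' ∈ depthChain r W) :
          f.1 *ᵥ (f'.1 *ᵥ v - v) - (f'.1 *ᵥ v - v) ∈ W j := by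
        have h3 : f'.1 *ᵥ v - v ∈ W (j + 1) := by
          refine hf'.2 (j + 1) v ?_
          rwa [add_assoc, add_comm 1 r]
        exact hf.2 j _ (hW.mono (by omega) h3)
      have h4 := sub_mem (h2 g h hg hh) (h2 h g hh hg)
      convert! h4 using 1
      simp only [Matrix.mulVec_sub]
      abel
  have h5 := key ((h * g)⁻¹.1 *ᵥ w) (inv_mem (mul_mem hh.1 hg.1) _ w hw)
  have h6 : ⁅g, h⁆.1 *ᵥ w - w =
      g.1 *ᵥ (h.1 *ᵥ ((h * g)⁻¹.1 *ᵥ w)) - h.1 *ᵥ (g.1 *ᵥ ((h * g)⁻¹.1 *ᵥ w)) := by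
    simp only [← mul_mulVec]
    rw [commutatorElement_def]
    simp [mul_assoc]
  rw [h6]
  exact h5

/-- The derived series of a subgroup, as a sequence of subgroups of the ambient group. -/
def derivedSubgroups {G : Type*} [Group G] (H : Subgroup G) : ℕ → Subgroup G
  | 0 => H
  | d + 1 => ⁅derivedSubgroups H d, derivedSubgroups H d⁆

theorem map_derivedSeries_subtype {G : Type*} [Group G] (H : Subgroup G) (d : ℕ) :
    (derivedSeries H d).map H.subtype = derivedSubgroups H d := by
  induction d with
  | zero => rw [derivedSeries_zero, ← MonoidHom.range_eq_map, Subgroup.range_subtype,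
      derivedSubgroups]
  | succ d ih => rw [derivedSeries_succ, Subgroup.map_commutator, ih, derivedSubgroups]

theorem isSolvable_iff_derivedSubgroups {G : Type*} [Group G] (H : Subgroup G) :
    Group.IsSolvable H ↔ ∃ d, derivedSubgroups H d = ⊥ := by
  rw [Group.isSolvable_def]
  refine exists_congr fun d => ?_
  rw [← map_derivedSeries_subtype, Subgroup.map_eq_bot_iff_of_injective _ H.subtype_injective]

/-- The d-th derived subgroup has depth d; at depth `Fintype.card m` every vector is fixed. -/
theorem isSolvable_stabChain {W : ℕ → Submodule K (m → K)} (hW : IsFullFlag W) :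
    Group.IsSolvable (stabChain W) := by
  refine (isSolvable_iff_derivedSubgroups _).2 ⟨Fintype.card m, ?_⟩
  have key (d : ℕ) : derivedSubgroups (stabChain W) d ≤ depthChain d W := by
    induction d with
    | zero => exact fun g hg => ⟨hg, fun j v hv => sub_mem (hg j v hv) hv⟩
    | succ d ih => exact (Subgroup.commutator_mono ih ih).trans (commutator_depthChain_le hW d)
  refine (Subgroup.eq_bot_iff_forall _).2 fun g hg => Units.ext ?_
  refine Matrix.ext_of_mulVec_single fun j => ?_
  have := (key _ hg).2 0 (Pi.single j 1) (by rw [zero_add, hW.top]; trivial)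
  rw [hW.zero, Submodule.mem_bot, sub_eq_zero] at this
  rw [this, Units.val_one, Matrix.one_mulVec]

theorem exists_GL_one_add_vecMulVec {v φ : m → K} (h : 1 + φ ⬝ᵥ v ≠ 0) :
    ∃ g : GL m K, g.1 = 1 + Matrix.vecMulVec v φ := by
  have hdet : (1 + Matrix.vecMulVec v φ).det ≠ 0 := by
    rwa [Matrix.vecMulVec_eq Unit, Matrix.det_one_add_replicateCol_mul_replicateRow]
  exact ⟨Matrix.GeneralLinearGroup.mkOfDetNeZero _ hdet, rfl⟩

theorem one_add_vecMulVec_mulVec (v φ w : m → K) :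
    (1 + Matrix.vecMulVec v φ) *ᵥ w = w + (φ ⬝ᵥ w) • v := by
  rw [Matrix.add_mulVec, Matrix.one_mulVec, Matrix.vecMulVec_mulVec, op_smul_eq_smul]

theorem exists_dotProduct_of_notMem {X : Submodule K (m → K)} {x : m → K} (hx : x ∉ X) :
    ∃ φ : m → K, φ ⬝ᵥ x ≠ 0 ∧ ∀ w ∈ X, φ ⬝ᵥ w = 0 := by
  obtain ⟨f, hfx, hf⟩ := Submodule.exists_le_ker_of_notMem hx
  have hdot (v : m → K) : (fun j => f (Pi.single j 1)) ⬝ᵥ v = f v := by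
    conv_rhs => rw [pi_eq_sum_univ' v]
    simp [dotProduct, mul_comm]
  exact ⟨fun j => f (Pi.single j 1), by rwa [hdot], fun w hw => by rw [hdot]; exact hf hw⟩

/-- Let W (i + 1) be the first member containing X, x ∈ X outside W i, and φ a functional killing W
i but not x. For y ∈ W (i + 1) the map v ↦ v + φ(v) y preserves the flag and moves x by a nonzero
multiple of y, so y ∈ X. -/
theorem IsFullFlag.eq_of_stable [CharZero K] {W : ℕ → Submodule K (m → K)} (hW : IsFullFlag W)
    {X : Submodule K (m → K)} (hX : ∀ g ∈ stabChain W, ∀ v ∈ X, g.1 *ᵥ v ∈ X) :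
    ∃ i ≤ Fintype.card m, X = W i := by
  classical
  have hex : ∃ i, X ≤ W i := ⟨_, by rw [hW.top]; exact le_top⟩
  have hi := Nat.find_spec hex
  have hcard : Nat.find hex ≤ Fintype.card m := Nat.find_min' hex (by rw [hW.top]; exact le_top)
  have hmin (j : ℕ) (hj : j < Nat.find hex) : ¬ X ≤ W j := Nat.find_min hex hj
  generalize Nat.find hex = i at hi hcard hmin
  refine ⟨i, hcard, le_antisymm hi ?_⟩
  rcases i with _ | i
  · rw [hW.zero]
    exact bot_le
  · obtain ⟨x, hxX, hxi⟩ := Set.not_subset.1 (hmin i i.lt_succ_self)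
    obtain ⟨φ, hφx, hφ⟩ := exists_dotProduct_of_notMem hxi
    intro y hy
    have key (y : m → K) (hy : y ∈ W (i + 1)) (h1 : 1 + φ ⬝ᵥ y ≠ 0) : y ∈ X := by
      obtain ⟨g, hg⟩ := exists_GL_one_add_vecMulVec h1
      have hgW : g ∈ stabChain W := by
        intro k v hv
        rw [hg, one_add_vecMulVec_mulVec]
        rcases le_or_gt k i with hk | hk
        · rw [hφ v (hW.mono hk hv), zero_smul, add_zero]
          exact hv
        · exact add_mem hv (Submodule.smul_mem _ _ (hW.mono hk hy))
      have h2 := sub_mem (hX g hgW x hxX) hxX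
      rw [hg, one_add_vecMulVec_mulVec, add_sub_cancel_left] at h2
      exact (Submodule.smul_mem_iff _ hφx).1 h2
    -- The map for y is singular exactly when φ(y) = −1; then −y works, its determinant being 2.
    by_cases h1 : 1 + φ ⬝ᵥ y = 0
    · rw [← neg_mem_iff]
      refine key (-y) (neg_mem hy) ?_
      have : φ ⬝ᵥ y = -1 := by linear_combination h1
      rw [dotProduct_neg, this]
      norm_num
    · exact key y hy h1

theorem IsFullFlag.eq_of_stabChain_le [CharZero K] {W W' : ℕ → Submodule K (m → K)}
    (hW : IsFullFlag W) (hW' : IsFullFlag W') (h : stabChain W ≤ stabChain W') {k : ℕ}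
    (hk : k ≤ Fintype.card m) : W' k = W k := by
  obtain ⟨i, hi, hki⟩ := hW.eq_of_stable (X := W' k) fun g hg v hv => h hg k v hv
  have h1 := hW'.finrank_eq hk
  rw [hki, hW.finrank_eq hi] at h1
  rw [hki, h1]

theorem IsFullFlag.stabChain_eq_of_le [CharZero K] {W W' : ℕ → Submodule K (m → K)}
    (hW : IsFullFlag W) (hW' : IsFullFlag W') (h : stabChain W ≤ stabChain W') :
    stabChain W' ≤ stabChain W := by
  intro g hg k v hv
  rcases le_total k (Fintype.card m) with hk | hk
  · rw [← hW.eq_of_stabChain_le hW' h hk] at hv ⊢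
    exact hg k v hv
  · have : W k = ⊤ := top_le_iff.1 (hW.top ▸ hW.mono hk)
    rw [this]
    trivial

end Chains

/-! ### The Lie–Kolchin theorem and Borel subgroups. -/

section LieKolchin

attribute [local instance] geometricTopology

variable {m : Type*} [Fintype m] [DecidableEq m] {K : Type*} [Field K]

theorem finite_setOf_eigenvalue_mod (A : Matrix m m K) {X : Submodule K (m → K)}
    (hA : ∀ v ∈ X, A *ᵥ v ∈ X) :
    {c : K | ∃ w ∉ X, A *ᵥ w - c • w ∈ X}.Finite := by
  refine (Module.End.finite_hasEigenvalue (X.mapQ X (Matrix.mulVecLin A) hA)).subset ?_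
  rintro c ⟨w, hw, hc⟩
  refine Module.End.hasEigenvalue_of_hasEigenvector (x := X.mkQ w) ⟨?_, ?_⟩
  · rw [Module.End.mem_eigenspace_iff]
    have : X.mkQ (A *ᵥ w - c • w) = 0 := (Submodule.Quotient.mk_eq_zero X).2 hc
    rw [map_sub, map_smul, sub_eq_zero] at this
    exact this
  · simpa using hw

theorem exists_eigenvector_mod [IsAlgClosed K] (A : Matrix m m K) {X Y : Submodule K (m → K)}
    (hX : ∀ v ∈ X, A *ᵥ v ∈ X) (hY : ∀ v ∈ Y, A *ᵥ v ∈ Y) (hXY : X < Y) :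
    ∃ y ∈ Y, y ∉ X ∧ ∃ c : K, A *ᵥ y - c • y ∈ X := by
  let f := X.mapQ X (Matrix.mulVecLin A) hX
  have hf : ∀ v ∈ Y.map X.mkQ, f v ∈ Y.map X.mkQ := by
    rintro _ ⟨v, hv, rfl⟩
    exact ⟨A *ᵥ v, hY v hv, rfl⟩
  obtain ⟨y₀, hy₀, hy₀X⟩ := Set.exists_of_ssubset hXY
  have : Nontrivial (Y.map X.mkQ) := by
    refine ⟨⟨X.mkQ y₀, y₀, hy₀, rfl⟩, 0, fun h => hy₀X ?_⟩
    simpa using congrArg Subtype.val h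
  obtain ⟨c, hc⟩ := Module.End.exists_eigenvalue (f.restrict hf)
  obtain ⟨⟨_, y, hy, rfl⟩, hyc⟩ := hc.exists_hasEigenvector
  refine ⟨y, hy, fun hyX => hyc.2 (Subtype.ext (by simpa using hyX)), c, ?_⟩
  have h1 : f (X.mkQ y) = c • X.mkQ y := congrArg Subtype.val hyc.apply_eq_smul
  have h2 : X.mkQ (A *ᵥ y - c • y) = 0 := by
    rw [map_sub, map_smul, sub_eq_zero]
    exact h1
  exact (Submodule.Quotient.mk_eq_zero X).1 h2

/-- The eigenvalue of A at g y modulo X takes finitely many values, each on a closed set of g, and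
these sets are disjoint on H; connectedness leaves only one. -/
theorem eigenvalue_constant {H : Subgroup (GL m K)} (hH : IsZariskiConnected H)
    (A : Matrix m m K) {X : Submodule K (m → K)} (hA : ∀ v ∈ X, A *ᵥ v ∈ X) {y : m → K}
    (hy : ∀ g ∈ H, g.1 *ᵥ y ∉ X)
    (he : ∀ g ∈ H, ∃ c : K, A *ᵥ (g.1 *ᵥ y) - c • (g.1 *ᵥ y) ∈ X) {c : K}
    (hc : A *ᵥ y - c • y ∈ X) :
    ∀ g ∈ H, A *ᵥ (g.1 *ᵥ y) - c • (g.1 *ᵥ y) ∈ X := by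
  have hH' : IsConnected (H : Set (GL m K)) := hH
  refine hH'.2.subset_of_finite_closed_cover (finite_setOf_eigenvalue_mod A hA)
    (Z := fun c => {g | A *ᵥ (g.1 *ᵥ y) - c • (g.1 *ᵥ y) ∈ X}) (fun c => ?_) (fun g hg => ?_)
    (fun g hg a b ha hb => ?_) H.one_mem (by simpa using hc)
  · have := isClosed_setOf_mulVec_mem (A - c • 1) y 0 X
    simpa only [Matrix.sub_mulVec, Matrix.smul_mulVec, Matrix.one_mulVec, sub_zero] using this
  · obtain ⟨c, hc⟩ := he g hg
    exact ⟨c, ⟨_, hy g hg, hc⟩, hc⟩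
  · by_contra hab
    have h1 : (A *ᵥ (g.1 *ᵥ y) - b • (g.1 *ᵥ y)) - (A *ᵥ (g.1 *ᵥ y) - a • (g.1 *ᵥ y)) ∈ X :=
      sub_mem hb ha
    rw [sub_sub_sub_cancel_left, ← sub_smul] at h1
    exact hy g hg ((Submodule.smul_mem_iff _ (sub_ne_zero.2 hab)).1 h1)

theorem mulVec_notMem {H : Subgroup (GL m K)} {X : Submodule K (m → K)}
    (hX : ∀ g ∈ H, ∀ v ∈ X, g.1 *ᵥ v ∈ X) {y : m → K} (hy : y ∉ X) :
    ∀ g ∈ H, g.1 *ᵥ y ∉ X := by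
  intro g hg h
  have := hX g⁻¹ (inv_mem hg) _ h
  rw [inv_mulVec_mulVec] at this
  exact hy this

/-- Induction on the derived length. Working with pairs X < Y of stable subspaces keeps everything
inside K^m while the claim is really about Y / X. -/
theorem exists_common_eigenvector_mod [IsAlgClosed K] (d : ℕ) :
    ∀ H : Subgroup (GL m K), IsZariskiConnected H → derivedSubgroups H d = ⊥ →
    ∀ X Y : Submodule K (m → K), (∀ g ∈ H, ∀ v ∈ X, g.1 *ᵥ v ∈ X) →
    (∀ g ∈ H, ∀ v ∈ Y, g.1 *ᵥ v ∈ Y) → X < Y →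
    ∃ v ∈ Y, v ∉ X ∧ ∀ g ∈ H, ∃ c : K, g.1 *ᵥ v - c • v ∈ X := by
  induction d with
  | zero =>
    intro H _ hd X Y _ _ hXY
    obtain ⟨v, hv, hvX⟩ := Set.exists_of_ssubset hXY
    refine ⟨v, hv, hvX, fun g hg => ⟨1, ?_⟩⟩
    rw [show H = ⊥ from hd, Subgroup.mem_bot] at hg
    simp [hg]
  | succ d ih =>
    intro H hH hd X Y₀ hX hY₀ hXY₀
    -- Minimality makes Y / X irreducible under H.
    obtain ⟨Y, ⟨hY, hXY, hYY₀⟩, hmin⟩ := (wellFounded_lt (α := Submodule K (m → K))).has_min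
      {Y | (∀ g ∈ H, ∀ v ∈ Y, g.1 *ᵥ v ∈ Y) ∧ X < Y ∧ Y ≤ Y₀} ⟨Y₀, hY₀, hXY₀, le_rfl⟩
    have hYmin (E : Submodule K (m → K)) (hE : ∀ g ∈ H, ∀ v ∈ E, g.1 *ᵥ v ∈ E) (hXE : X < E)
        (hEY : E ≤ Y) : E = Y := by
      by_contra hne
      exact hmin E ⟨hE, hXE, hEY.trans hYY₀⟩ (lt_of_le_of_ne hEY hne)
    have hcomm : derivedSubgroups ⁅H, H⁆ d = ⊥ := by
      have (d : ℕ) : derivedSubgroups ⁅H, H⁆ d = derivedSubgroups H (d + 1) := by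
        induction d with
        | zero => rfl
        | succ d ih =>
          change ⁅derivedSubgroups ⁅H, H⁆ d, derivedSubgroups ⁅H, H⁆ d⁆ = _
          rw [ih]
          rfl
      rw [this, hd]
    have hle : ⁅H, H⁆ ≤ H := Subgroup.commutator_le_self H
    obtain ⟨v, hvY, hvX, hv⟩ := ih ⁅H, H⁆ (isConnected_commutator hH) hcomm X Y
      (fun g hg => hX g (hle hg)) (fun g hg => hY g (hle hg)) hXY
    -- The eigenspace of the commutator group for the character χ is H-stable, since conjugation by
    -- the connected group H cannot change the eigenvalue; by irreducibility it is all of Y / X.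
    have hscalar : ∀ h ∈ ⁅H, H⁆, ∃ c : K, ∀ y ∈ Y, h.1 *ᵥ y - c • y ∈ X := by
      choose! χ hχ using hv
      let E : Submodule K (m → K) :=
        { carrier := {y | y ∈ Y ∧ ∀ h ∈ ⁅H, H⁆, h.1 *ᵥ y - χ h • y ∈ X}
          zero_mem' := ⟨zero_mem _, fun h _ => by simp⟩
          add_mem' := fun {a b} ha hb => ⟨add_mem ha.1 hb.1, fun h hh => by
            rw [Matrix.mulVec_add, smul_add, add_sub_add_comm]
            exact add_mem (ha.2 h hh) (hb.2 h hh)⟩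
          smul_mem' := fun a y hy => ⟨Submodule.smul_mem _ _ hy.1, fun h hh => by
            rw [Matrix.mulVec_smul, smul_comm, ← smul_sub]
            exact Submodule.smul_mem _ _ (hy.2 h hh)⟩ }
      have hXE : X ≤ E := fun x hx =>
        ⟨hXY.le hx, fun h hh => sub_mem (hX h (hle hh) x hx) (Submodule.smul_mem _ _ hx)⟩
      have hE : E = Y := by
        refine hYmin E (fun g hg y hy => ?_)
          (lt_of_le_of_ne hXE fun h => hvX (h ▸ (⟨hvY, hχ⟩ : v ∈ E))) fun y hy => hy.1
        by_cases hyX : y ∈ X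
        · exact hXE (hX g hg y hyX)
        refine ⟨hY g hg y hy.1, fun h hh => ?_⟩
        refine eigenvalue_constant hH h.1 (hX h (hle hh)) (mulVec_notMem hX hyX)
          (fun g' hg' => ⟨χ (g'⁻¹ * h * g'), ?_⟩) (hy.2 h hh) g hg
        have h1 : g'⁻¹ * h * g' ∈ ⁅H, H⁆ := by
          have : ⁅g'⁻¹, h⁆ * h = g'⁻¹ * h * g' := by simp [commutatorElement_def, mul_assoc]
          rw [← this]
          exact mul_mem (Subgroup.commutator_mem_commutator (inv_mem hg') (hle hh)) hh
        have h2 := hX g' hg' _ (hy.2 _ h1)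
        rwa [Matrix.mulVec_sub, Matrix.mulVec_smul, mul_assoc, mul_mulVec, mulVec_inv_mulVec,
          mul_mulVec, ← mul_assoc] at h2
      intro h hh
      exact ⟨χ h, fun y hy => (hE ▸ hy : y ∈ E).2 h hh⟩
    refine ⟨v, hYY₀ hvY, hvX, fun k hk => ?_⟩
    obtain ⟨y, hyY, hyX, μ, hμ⟩ := exists_eigenvector_mod k.1 (hX k hk) (hY k hk) hXY
    refine ⟨μ, ?_⟩
    -- From k g = ⁅k, g⁆ g k and scalar commutators, g y is again an eigenvector of k, with the same
    -- eigenvalue by connectedness. Irreducibility then makes k scalar on Y / X.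
    have hgy := eigenvalue_constant hH k.1 (hX k hk) (mulVec_notMem hX hyX) (fun g hg => by
      obtain ⟨c, hc⟩ := hscalar ⁅k, g⁆ (Subgroup.commutator_mem_commutator hk hg)
      refine ⟨c * μ, ?_⟩
      have h1 := hc _ (hY g hg _ (hY k hk y hyY))
      have h2 := Submodule.smul_mem _ c (hX g hg _ hμ)
      have h3 : ⁅k, g⁆ * g * k = k * g := by simp [commutatorElement_def, mul_assoc]
      rw [← mul_mulVec, ← mul_mulVec, h3, mul_mulVec] at h1
      rw [Matrix.mulVec_sub, Matrix.mulVec_smul, smul_sub, smul_smul] at h2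
      have h4 := add_mem h1 h2
      rwa [sub_add_sub_cancel] at h4) hμ
    let E : Submodule K (m → K) :=
      { carrier := {z | z ∈ Y ∧ ∀ g ∈ H, k.1 *ᵥ (g.1 *ᵥ z) - μ • (g.1 *ᵥ z) ∈ X}
        zero_mem' := ⟨zero_mem _, fun h _ => by simp⟩
        add_mem' := fun {a b} ha hb => ⟨add_mem ha.1 hb.1, fun h hh => by
          rw [Matrix.mulVec_add, Matrix.mulVec_add, smul_add, add_sub_add_comm]
          exact add_mem (ha.2 h hh) (hb.2 h hh)⟩
        smul_mem' := fun a y hy => ⟨Submodule.smul_mem _ _ hy.1, fun h hh => by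
          rw [Matrix.mulVec_smul, Matrix.mulVec_smul, smul_comm, ← smul_sub]
          exact Submodule.smul_mem _ _ (hy.2 h hh)⟩ }
    have hXE : X ≤ E := fun x hx => ⟨hXY.le hx, fun g hg =>
      sub_mem (hX k hk _ (hX g hg x hx)) (Submodule.smul_mem _ _ (hX g hg x hx))⟩
    have hE : E = Y := by
      refine hYmin E (fun g hg z hz => ⟨hY g hg z hz.1, fun g' hg' => ?_⟩)
        (lt_of_le_of_ne hXE fun h => hyX (h ▸ (⟨hyY, hgy⟩ : y ∈ E))) fun z hz => hz.1
      rw [← mul_mulVec g' g]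
      exact hz.2 _ (mul_mem hg' hg)
    have := (hE ▸ hvY : v ∈ E).2 1 H.one_mem
    simpa using this

theorem exists_stable_extension [IsAlgClosed K] {H : Subgroup (GL m K)}
    (hH : IsZariskiConnected H) (hs : Group.IsSolvable H) {X : Submodule K (m → K)}
    (hX : ∀ g ∈ H, ∀ v ∈ X, g.1 *ᵥ v ∈ X) :
    ∃ X' : Submodule K (m → K), (∀ g ∈ H, ∀ v ∈ X', g.1 *ᵥ v ∈ X') ∧ X ≤ X' ∧
      (X = ⊤ ∨ X < X') ∧ ∃ e ∈ X', X' ≤ X ⊔ Submodule.span K {e} := by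
  by_cases hT : X = ⊤
  · exact ⟨X, hX, le_rfl, Or.inl hT, 0, zero_mem _, le_sup_left⟩
  · obtain ⟨d, hd⟩ := (isSolvable_iff_derivedSubgroups H).1 hs
    obtain ⟨v, -, hvX, hv⟩ := exists_common_eigenvector_mod d H hH hd X ⊤ hX
      (fun _ _ _ _ => trivial) (lt_top_iff_ne_top.2 hT)
    have hvm : v ∈ X ⊔ Submodule.span K {v} :=
      Submodule.mem_sup_right (Submodule.mem_span_singleton_self v)
    refine ⟨X ⊔ Submodule.span K {v}, fun g hg w hw => ?_, le_sup_left,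
      Or.inr (lt_of_le_of_ne le_sup_left fun h => hvX (h ▸ hvm)), v, hvm, le_rfl⟩
    obtain ⟨x, hx, z, hz, rfl⟩ := Submodule.mem_sup.1 hw
    obtain ⟨a, rfl⟩ := Submodule.mem_span_singleton.1 hz
    obtain ⟨c, hc⟩ := hv g hg
    have h1 : g.1 *ᵥ (x + a • v) = (g.1 *ᵥ x + a • (g.1 *ᵥ v - c • v)) + (a * c) • v := by
      rw [Matrix.mulVec_add, Matrix.mulVec_smul]
      module
    rw [h1]
    exact Submodule.add_mem_sup (add_mem (hX g hg x hx) (Submodule.smul_mem _ _ hc))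
      (Submodule.smul_mem _ _ (Submodule.mem_span_singleton_self v))

/-- The Lie–Kolchin theorem: a connected solvable subgroup of `GL m K` preserves a full flag. -/
theorem exists_fullFlag_of_isSolvable [IsAlgClosed K] {H : Subgroup (GL m K)}
    (hH : IsZariskiConnected H) (hs : Group.IsSolvable H) :
    ∃ W : ℕ → Submodule K (m → K), IsFullFlag W ∧ H ≤ stabChain W := by
  choose! next h1 h2 h3 h4 using
    fun (X : Submodule K (m → K)) (hX : ∀ g ∈ H, ∀ v ∈ X, g.1 *ᵥ v ∈ X) =>
      exists_stable_extension hH hs hX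
  let W : ℕ → Submodule K (m → K) := fun k => next^[k] ⊥
  have hsucc (k : ℕ) : W (k + 1) = next (W k) := Function.iterate_succ_apply' _ _ _
  have hst (k : ℕ) : ∀ g ∈ H, ∀ v ∈ W k, g.1 *ᵥ v ∈ W k := by
    induction k with
    | zero =>
      intro g _ v hv
      rw [show v = 0 from hv, Matrix.mulVec_zero]
      exact zero_mem _
    | succ k ih => rw [hsucc]; exact h1 _ ih
  -- Until the whole space is reached every extension is strict, so `Fintype.card m` extensions
  -- suffice.
  have hrank (k : ℕ) : W k = ⊤ ∨ k ≤ Module.finrank K (W k) := by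
    induction k with
    | zero => exact Or.inr (Nat.zero_le _)
    | succ k ih =>
      rw [hsucc]
      rcases h3 _ (hst k) with h | h
      · exact Or.inl (top_le_iff.1 (h ▸ h2 _ (hst k)))
      · rcases ih with ih | ih
        · exact absurd h (by rw [ih]; exact not_top_lt)
        · have := Submodule.finrank_lt_finrank_of_lt h
          exact Or.inr (by omega)
  refine ⟨W, ⟨monotone_nat_of_le_succ fun k => ?_, rfl, ?_, fun k => ?_⟩,
    fun g hg k v hv => hst k g hg v hv⟩
  · rw [hsucc]
    exact h2 _ (hst k)
  · rcases hrank (Fintype.card m) with h | h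
    · exact h
    · refine Submodule.eq_top_of_finrank_eq (le_antisymm (Submodule.finrank_le _) ?_)
      rwa [Module.finrank_fintype_fun_eq_card]
  · rw [hsucc]
    exact h4 _ (hst k)

/-- A connected solvable overgroup fixes some full flag W', which is then stable under `stabChain W`
and must agree with W. -/
theorem isBorel_stabChain [IsAlgClosed K] [CharZero K] {W : ℕ → Submodule K (m → K)}
    (hW : IsFullFlag W) : IsBorel (stabChain W) := by
  refine ⟨⟨isAlgSubgroup_stabChain W, isZariskiConnected_stabChain W, isSolvable_stabChain hW⟩,
    fun H ⟨_, hH, hs⟩ hle => ?_⟩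
  obtain ⟨W', hW', hHW'⟩ := exists_fullFlag_of_isSolvable hH hs
  exact hHW'.trans (hW.stabChain_eq_of_le hW' (hle.trans hHW'))

theorem IsBorel.exists_fullFlag [IsAlgClosed K] [CharZero K] {B : Subgroup (GL m K)}
    (hB : IsBorel B) : ∃ W : ℕ → Submodule K (m → K), IsFullFlag W ∧ stabChain W ≤ B := by
  obtain ⟨W, hW, hBW⟩ := exists_fullFlag_of_isSolvable hB.1.2.1 hB.1.2.2
  exact ⟨W, hW, hB.2 (isBorel_stabChain hW).1 hBW⟩

end LieKolchin

/-! ### Block parabolic subgroups: unipotent radical and Levi subgroup. -/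

section BlockParabolic

attribute [local instance] geometricTopology

variable {m : Type*} [Fintype m] [DecidableEq m] {K : Type*} [Field K]

/-- The chain of coordinate subspaces attached to a grading of the indices. -/
def coordChain (K : Type*) [Field K] (b : m → ℕ) (k : ℕ) : Submodule K (m → K) where
  carrier := {v | ∀ j, k ≤ b j → v j = 0}
  zero_mem' := fun _ _ => rfl
  add_mem' := fun {v w} hv hw j hj => by rw [Pi.add_apply, hv j hj, hw j hj, add_zero]
  smul_mem' := fun a v hv j hj => by rw [Pi.smul_apply, hv j hj, smul_zero]

theorem coordChain_mono (b : m → ℕ) : Monotone (coordChain K b) :=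
  fun _ _ hkl _ hv j hj => hv j (hkl.trans hj)

theorem coordChain_zero (b : m → ℕ) : coordChain K b 0 = ⊥ :=
  (Submodule.eq_bot_iff _).2 fun _ hv => funext fun j => hv j (Nat.zero_le _)

theorem coordChain_top {b : m → ℕ} {N : ℕ} (hN : ∀ j, b j < N) : coordChain K b N = ⊤ :=
  top_le_iff.1 fun _ _ j hj => absurd (hN j) (not_lt.2 hj)

theorem single_mem_coordChain (b : m → ℕ) {j : m} {k : ℕ} (hjk : b j < k) :
    Pi.single j (1 : K) ∈ coordChain K b k := by
  intro i hi
  rw [Pi.single_eq_of_ne]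
  rintro rfl
  omega

theorem mem_stabChain_coordChain {b : m → ℕ} {g : GL m K} :
    g ∈ stabChain (coordChain K b) ↔ ∀ i j, b j < b i → g.1 i j = 0 := by
  constructor
  · intro hg i j hij
    have := hg (b j + 1) _ (single_mem_coordChain b (Nat.lt_succ_self _)) i hij
    rwa [Matrix.mulVec_single_one] at this
  · intro hg k v hv i hi
    refine Finset.sum_eq_zero fun j _ => ?_
    rcases le_or_gt k (b j) with h | h
    · rw [hv j h, mul_zero]
    · exact mul_eq_zero_of_left (hg i j (h.trans_le hi)) _

theorem mem_depthChain_coordChain {b : m → ℕ} {g : GL m K} :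
    g ∈ depthChain 1 (coordChain K b) ↔
      ∀ i j, b j ≤ b i → g.1 i j = (1 : Matrix m m K) i j := by
  rw [mem_depthChain]
  constructor
  · rintro ⟨-, hg⟩ i j hij
    have := hg (b j) _ (single_mem_coordChain b (Nat.lt_succ_self _)) i hij
    rw [Matrix.mulVec_single_one, Pi.sub_apply, sub_eq_zero] at this
    rw [show g.1 i j = _ from this, Matrix.one_apply, Pi.single_apply]
  · intro hg
    refine ⟨mem_stabChain_coordChain.2 fun i j hij => ?_, fun k v hv i hi => ?_⟩
    · rw [hg i j hij.le, Matrix.one_apply_ne (by rintro rfl; omega)]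
    · have : g.1 *ᵥ v - v = (g.1 - 1) *ᵥ v := by rw [Matrix.sub_mulVec, Matrix.one_mulVec]
      rw [this]
      refine Finset.sum_eq_zero fun j _ => ?_
      rcases le_or_gt (k + 1) (b j) with h | h
      · rw [hv j h, mul_zero]
      · refine mul_eq_zero_of_left ?_ _
        change (g.1 - 1) i j = 0
        rw [Matrix.sub_apply, hg i j (by omega), sub_self]

/-- An elementary transvection as an element of the general linear group. -/
def transvectionGL (i j : m) (hij : i ≠ j) (c : K) : GL m K where
  val := Matrix.transvection i j c
  inv := Matrix.transvection i j (-c)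
  val_inv := by
    rw [Matrix.transvection_mul_transvection_same i j hij, add_neg_cancel, Matrix.transvection_zero]
  inv_val := by
    rw [Matrix.transvection_mul_transvection_same i j hij, neg_add_cancel, Matrix.transvection_zero]

theorem trace_eq_zero_of_isNilpotent {A : Matrix m m K} (hA : IsNilpotent A) : A.trace = 0 :=
  (Matrix.isNilpotent_trace_of_isNilpotent hA).eq_zero

/-- For v, w ∈ U the trace of (v − 1)(w − 1) vanishes, as it is a combination of traces of nilpotent
matrices. Applied to u and its conjugates by transvections inside a block, this kills the
off-diagonal entries of the diagonal blocks of u − 1. -/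
theorem mem_depthChain_of_normal_unipotent {b : m → ℕ} {U : Subgroup (GL m K)}
    (hU : U ≤ stabChain (coordChain K b))
    (hn : stabChain (coordChain K b) ≤ Subgroup.normalizer (U : Set (GL m K)))
    (hu : ∀ u ∈ U, IsNilpotent (u.1 - 1)) : U ≤ depthChain 1 (coordChain K b) := by
  intro u huU
  have htr (v w : GL m K) (hv : v ∈ U) (hw : w ∈ U) :
      ((v.1 - 1) * (w.1 - 1)).trace = 0 := by
    have h : (v.1 - 1) * (w.1 - 1) = ((v * w).1 - 1) - (v.1 - 1) - (w.1 - 1) := by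
      rw [Units.val_mul]
      noncomm_ring
    rw [h, Matrix.trace_sub, Matrix.trace_sub, trace_eq_zero_of_isNilpotent (hu _ (mul_mem hv hw)),
      trace_eq_zero_of_isNilpotent (hu _ hv), trace_eq_zero_of_isNilpotent (hu _ hw)]
    simp
  set A := u.1 - 1 with hA
  have htri : A.BlockTriangular b := by
    intro i j hij
    rw [hA, Matrix.sub_apply, mem_stabChain_coordChain.1 (hU huU) i j hij,
      Matrix.one_apply_ne (by rintro rfl; omega), sub_zero]
  have hoff (i j : m) (hij : i ≠ j) (hb : b i = b j) : A j i = 0 := by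
    have hg : transvectionGL i j hij (1 : K) ∈ stabChain (coordChain K b) := by
      refine mem_stabChain_coordChain.2 fun k l hkl => ?_
      change (1 + Matrix.single i j (1 : K)) k l = 0
      rw [Matrix.add_apply, Matrix.one_apply_ne (by rintro rfl; omega), zero_add,
        Matrix.single_apply_of_ne]
      rintro ⟨rfl, rfl⟩
      omega
    -- With E the matrix unit at (i, j), the trace of A (1 + E) A (1 − E) reduces to −(A j i)²,
    -- because the trace of A² is zero.
    have h1 := htr _ _ huU ((Subgroup.mem_normalizer_iff.1 (hn hg) u).1 huU)
    have h2 := htr _ _ huU huU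
    set E : Matrix m m K := Matrix.single i j 1
    have h3 : (transvectionGL i j hij (1 : K) * u * (transvectionGL i j hij (1 : K))⁻¹).1 - 1 =
        (1 + E) * A * (1 - E) := by
      have h4 : (transvectionGL i j hij (1 : K)).1 = 1 + E := rfl
      have h5 : ((transvectionGL i j hij (1 : K))⁻¹).1 = 1 - E := by
        change 1 + Matrix.single i j (-1 : K) = 1 - E
        simp only [E, sub_eq_add_neg, add_right_inj]
        ext k l
        simp [Matrix.single_apply, apply_ite]
      have h6 : (1 + E) * (1 - E) = 1 := by rw [← h4, ← h5, Units.mul_inv]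
      rw [Units.val_mul, Units.val_mul, h4, h5, hA, mul_sub (1 + E), sub_mul _ _ (1 - E), mul_one,
        h6]
    rw [h3] at h1
    have h7 : A * ((1 + E) * A * (1 - E)) = A * A + A * E * A - A * (A * E) - A * (E * A * E) := by
      noncomm_ring
    rw [h7, Matrix.trace_sub, Matrix.trace_sub, Matrix.trace_add, h2,
      Matrix.trace_mul_comm (A * E) A, zero_add, sub_self, zero_sub, neg_eq_zero] at h1
    have h8 : E * A * E = Matrix.single i j (A j i) := by
      simp only [E, Matrix.single_mul_mul_single, one_mul, mul_one]
    rw [h8, Matrix.trace_mul_single] at h1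
    simpa using h1
  have hdiag (i : m) : A i i = 0 := by
    -- The diagonal blocks of A are now diagonal, so powers of A have the powers of its diagonal
    -- entries on the diagonal, and nilpotency kills these.
    have hpow (k : ℕ) : (A ^ k).BlockTriangular b ∧ (A ^ k) i i = A i i ^ k := by
      induction k with
      | zero => exact ⟨by rw [pow_zero]; exact Matrix.blockTriangular_one, by simp⟩
      | succ k ih =>
        refine ⟨by rw [pow_succ]; exact ih.1.mul htri, ?_⟩
        rw [pow_succ, Matrix.mul_apply, Finset.sum_eq_single i, ih.2, pow_succ]
        · intro l _ hl
          rcases lt_trichotomy (b l) (b i) with h | h | h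
          · rw [ih.1 h, zero_mul]
          · rw [hoff i l hl.symm h.symm, mul_zero]
          · rw [htri h, mul_zero]
        · simp
    obtain ⟨N, hN⟩ := hu u huU
    have := (hpow N).2
    rw [hA, hN] at this
    exact eq_zero_of_pow_eq_zero this.symm
  refine mem_depthChain_coordChain.2 fun i j hij => ?_
  rw [← sub_eq_zero, ← Matrix.sub_apply]
  rcases hij.lt_or_eq with h | h
  · exact htri h
  · by_cases hij : i = j
    · subst hij
      exact hdiag i
    · exact hoff j i (Ne.symm hij) h

theorem unipotentRadical_stabChain_coordChain [Infinite K] (b : m → ℕ) :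
    unipotentRadical (stabChain (coordChain K b)) = depthChain 1 (coordChain K b) := by
  obtain ⟨N, hN⟩ : ∃ N, ∀ j, b j < N :=
    ⟨Finset.univ.sup b + 1, fun j => Nat.lt_succ_of_le (Finset.le_sup (Finset.mem_univ j))⟩
  refine le_antisymm (sSup_le fun U hU => mem_depthChain_of_normal_unipotent hU.1 hU.2.2.2.1
    hU.2.2.2.2) (le_sSup ⟨fun g hg => hg.1, isAlgSubgroup_depthChain _ _,
      isZariskiConnected_depthChain _ _, ?_, fun u hu =>
        isNilpotent_sub_one_of_mem_depthChain (coordChain_zero b) (coordChain_top hN) hu⟩)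
  exact le_normalizer_of_conj_mem fun g hg u hu => conj_mem_depthChain hg hu

/-- The block diagonal part of a matrix. -/
def blockPart (b : m → ℕ) (M : Matrix m m K) : Matrix m m K :=
  Matrix.of fun i j => if b i = b j then M i j else 0

theorem blockPart_mul {b : m → ℕ} {M N : Matrix m m K} (hM : M.BlockTriangular b)
    (hN : N.BlockTriangular b) : blockPart b M * blockPart b N = blockPart b (M * N) := by
  ext i j
  simp only [blockPart, Matrix.mul_apply, Matrix.of_apply]
  split_ifs with hij
  · refine Finset.sum_congr rfl fun k _ => ?_
    by_cases h : b i = b k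
    · rw [if_pos h, if_pos (h.symm.trans hij)]
    · rw [if_neg h, zero_mul]
      rcases lt_or_gt_of_ne h with h | h
      · rw [hN (by omega : b j < b k), mul_zero]
      · rw [hM h, zero_mul]
  · refine Finset.sum_eq_zero fun k _ => ?_
    split_ifs with h1 h2
    · exact absurd (h1.trans h2) hij
    all_goals simp

theorem blockPart_one (b : m → ℕ) : blockPart b (1 : Matrix m m K) = 1 := by
  ext i j
  simp only [blockPart, Matrix.of_apply, Matrix.one_apply]
  split_ifs with h1 h2 h3
  · rfl
  · rfl
  · exact absurd (congrArg b h3) h1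
  · rfl

/-- Taking the block diagonal part is multiplicative on block triangular matrices, so the part of g
is inverted by the part of g⁻¹. -/
theorem exists_blockDiagonal_mul {b : m → ℕ} {g : GL m K}
    (hg : g ∈ stabChain (coordChain K b)) :
    ∃ l : GL m K, (∀ i j, b i ≠ b j → l.1 i j = 0) ∧ l⁻¹ * g ∈ depthChain 1 (coordChain K b) := by
  have h1 : g.1.BlockTriangular b := fun i j hij => mem_stabChain_coordChain.1 hg i j hij
  have h2 : (g⁻¹).1.BlockTriangular b :=
    fun i j hij => mem_stabChain_coordChain.1 (inv_mem hg) i j hij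
  let l : GL m K := ⟨blockPart b g.1, blockPart b (g⁻¹).1,
    by rw [blockPart_mul h1 h2, Units.mul_inv, blockPart_one],
    by rw [blockPart_mul h2 h1, Units.inv_mul, blockPart_one]⟩
  have hl : ∀ i j, b i ≠ b j → l.1 i j = 0 := fun i j hij => if_neg hij
  refine ⟨l, hl, mem_depthChain_coordChain.2 fun i j hij => ?_⟩
  rcases hij.lt_or_eq with h | h
  · have hlm : l ∈ stabChain (coordChain K b) :=
      mem_stabChain_coordChain.2 fun i j hij => hl i j hij.ne'
    rw [mem_stabChain_coordChain.1 (mul_mem (inv_mem hlm) hg) i j h,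
      Matrix.one_apply_ne (by rintro rfl; omega)]
  · have h3 : blockPart b (g⁻¹).1 * blockPart b g.1 = 1 := by
      rw [blockPart_mul h2 h1, Units.inv_mul, blockPart_one]
    rw [← h3]
    change (blockPart b (g⁻¹).1 * g.1) i j = _
    rw [Matrix.mul_apply, Matrix.mul_apply]
    refine Finset.sum_congr rfl fun k _ => ?_
    simp only [blockPart, Matrix.of_apply]
    split_ifs with h4 h5 h5
    · rfl
    · exact absurd (h4.symm.trans h.symm) h5
    · simp
    · simp

theorem isLevi_blockDiagonal [Infinite K] {b : m → ℕ} {L : Subgroup (GL m K)}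
    (hL : ∀ g, g ∈ L ↔ ∀ i j, b i ≠ b j → g.1 i j = 0) :
    IsLevi L (stabChain (coordChain K b)) := by
  rw [IsLevi, unipotentRadical_stabChain_coordChain]
  refine ⟨?_, ?_, le_antisymm (sup_le (fun g hg => ?_) fun g hg => hg.1) fun g hg => ?_⟩
  · change IsClosed (L : Set (GL m K))
    have : (L : Set (GL m K)) = ⋂ i, ⋂ j, ⋂ _ : b i ≠ b j,
        {g : GL m K | (Matrix.entryLinearMap K K i j) g.1 = 0} := by
      ext g
      simp [hL]
    rw [this]
    exact isClosed_iInter fun i => isClosed_iInter fun j => isClosed_iInter fun _ =>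
      isClosed_setOf_linear_eq _ _
  · refine (Subgroup.eq_bot_iff_forall _).2 fun g ⟨hgL, hgU⟩ => Units.ext ?_
    ext i j
    rw [Units.val_one]
    by_cases h : b i = b j
    · exact mem_depthChain_coordChain.1 hgU i j h.ge
    · rw [(hL g).1 hgL i j h, Matrix.one_apply_ne (by rintro rfl; exact h rfl)]
  · exact mem_stabChain_coordChain.2 fun i j hij => (hL g).1 hg i j hij.ne'
  · obtain ⟨l, hl, hlg⟩ := exists_blockDiagonal_mul hg
    have := mul_mem (Subgroup.mem_sup_left (T := depthChain 1 (coordChain K b)) ((hL l).2 hl))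
      (Subgroup.mem_sup_right (S := L) hlg)
    rwa [mul_inv_cancel_left] at this

/-- The coordinate chain attached to an enumeration of the indices is a full flag. -/
theorem isFullFlag_coordChain {σ : m → ℕ} (hσ : Function.Injective σ)
    (hlt : ∀ j, σ j < Fintype.card m) : IsFullFlag (coordChain K σ) where
  mono := coordChain_mono σ
  zero := coordChain_zero σ
  top := coordChain_top hlt
  step k := by
    by_cases hk : ∃ j, σ j = k
    · obtain ⟨j, rfl⟩ := hk
      refine ⟨Pi.single j 1, single_mem_coordChain σ (Nat.lt_succ_self _), fun v hv => ?_⟩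
      have h : v = (v - v j • Pi.single j 1) + v j • Pi.single j 1 := by simp
      rw [h]
      refine Submodule.add_mem_sup (fun i hi => ?_)
        (Submodule.smul_mem _ _ (Submodule.mem_span_singleton_self _))
      rcases hi.lt_or_eq with h | h
      · have hij : i ≠ j := by rintro rfl; omega
        simp [hv i h, Pi.single_eq_of_ne hij]
      · rw [← hσ h]
        simp
    -- No index has value k, so the chain does not grow here and e = 0 serves.
    · refine ⟨0, zero_mem _, fun v hv => Submodule.mem_sup_left fun j hj => hv j ?_⟩
      have : σ j ≠ k := fun h => hk ⟨j, h⟩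
      omega

end BlockParabolic

/-! ### Split tori and the diagonal torus. -/

section Tori

variable {m : Type*} [Fintype m] [DecidableEq m]

theorem coe_diagHom {R : Type*} [CommRing R] (a : m → Rˣ) :
    (diagHom m R a).1 = Matrix.diagonal fun i => (a i : R) :=
  rfl

theorem diagHom_injective {R : Type*} [CommRing R] : Function.Injective (diagHom m R) := by
  intro a b hab
  have h := congrArg Units.val hab
  rw [coe_diagHom, coe_diagHom, Matrix.diagonal_eq_diagonal_iff] at h
  exact funext fun i => Units.ext (h i)

variable {K : Type*} [Field K]

theorem diag_ne_zero {g : GL m K} (hg : ∀ i j, i ≠ j → g.1 i j = 0) (i : m) : g.1 i i ≠ 0 := by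
  intro h0
  have h : (g.1 * (g⁻¹).1) i i = 1 := by rw [Units.mul_inv, Matrix.one_apply_eq]
  rw [Matrix.mul_apply, Finset.sum_eq_zero] at h
  · exact zero_ne_one h
  · intro k _
    by_cases hik : i = k
    · rw [← hik, h0, zero_mul]
    · rw [hg i k hik, zero_mul]

theorem mem_diagonalSubgroup_iff {g : GL m K} :
    g ∈ diagonalSubgroup m K ↔ ∀ i j, i ≠ j → g.1 i j = 0 := by
  constructor
  · rintro ⟨a, rfl⟩ i j hij
    rw [coe_diagHom, Matrix.diagonal_apply_ne _ hij]
  · intro hg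
    refine ⟨fun i => Units.mk0 (g.1 i i) (diag_ne_zero hg i), Units.ext ?_⟩
    ext i j
    rw [coe_diagHom]
    by_cases hij : i = j
    · subst hij
      simp
    · rw [Matrix.diagonal_apply_ne _ hij, hg i j hij]

theorem IsSplitTorus.commute {k : Type*} [Field k] [Algebra k K] {T : Subgroup (GL m K)}
    (hT : IsSplitTorus k T) {x y : GL m K} (hx : x ∈ T) (hy : y ∈ T) : x * y = y * x := by
  obtain ⟨-, r, e, -, -⟩ := hT
  have h : e (⟨x, hx⟩ * ⟨y, hy⟩) = e (⟨y, hy⟩ * ⟨x, hx⟩) := by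
    rw [map_mul, map_mul]
    obtain ⟨a, ha⟩ := (e ⟨x, hx⟩).2
    obtain ⟨b, hb⟩ := (e ⟨y, hy⟩).2
    refine Subtype.ext ?_
    rw [Subgroup.coe_mul, Subgroup.coe_mul, ← ha, ← hb]
    refine Units.ext ?_
    rw [Units.val_mul, Units.val_mul, coe_diagHom, coe_diagHom, Matrix.diagonal_mul_diagonal,
      Matrix.diagonal_mul_diagonal]
    simp only [mul_comm]
  exact congrArg Subtype.val (e.injective h)

/-- If `g` commutes with a diagonal matrix, its entries vanish wherever the two corresponding
diagonal entries differ. -/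
theorem entry_eq_zero_of_commute {g d : GL m K} {a : m → K} (hd : d.1 = Matrix.diagonal a)
    (h : g * d = d * g) {i j : m} (hij : a i ≠ a j) : g.1 i j = 0 := by
  have h0 : (g * d).1 = (d * g).1 := congrArg Units.val h
  have h1 := congrFun₂ h0 i j
  rw [Units.val_mul, Units.val_mul, hd, Matrix.mul_diagonal, Matrix.diagonal_mul] at h1
  have h2 : (a i - a j) * g.1 i j = 0 := by linear_combination -h1
  exact (mul_eq_zero.1 h2).resolve_left (sub_ne_zero.2 hij)

theorem isAlgSubgroup_diagonalSubgroup (k : Type*) [Field k] [Algebra k K] :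
    IsAlgSubgroup k (diagonalSubgroup m K) := by
  have := isClosed_setOf_aeval_eq_zero (m := m) (K := K) k
    {p | ∃ i j, i ≠ j ∧ p = MvPolynomial.X (i, j)}
  unfold IsAlgSubgroup
  convert! this using 1
  ext g
  simp only [SetLike.mem_coe, mem_diagonalSubgroup_iff, Set.mem_ofPred_eq]
  constructor
  · rintro h _ ⟨i, j, hij, rfl⟩
    rw [MvPolynomial.aeval_X]
    exact h i j hij
  · intro h i j hij
    have := h _ ⟨i, j, hij, rfl⟩
    rwa [MvPolynomial.aeval_X] at this

theorem isSplitTorus_diagonalSubgroup (k : Type*) [Field k] [Algebra k K] (r : ℕ) :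
    IsSplitTorus k (diagonalSubgroup (Fin r) K) := by
  refine ⟨isAlgSubgroup_diagonalSubgroup k, r, MulEquiv.refl _, fun i j => ?_, fun i j => ?_⟩
  all_goals exact ⟨MvPolynomial.X (i, j), 0, fun g => by simp [coords]⟩

/-- A larger torus commutes with the matrix having 2 at place i and 1 elsewhere on the diagonal,
which isolates row i. -/
theorem maximal_isSplitTorus_diagonalSubgroup (k : Type*) [Field k] [Algebra k K] [CharZero K]
    (r : ℕ) : Maximal (IsSplitTorus k) (diagonalSubgroup (Fin r) K) := by
  refine ⟨isSplitTorus_diagonalSubgroup k r, fun T hT hle g hg => ?_⟩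
  refine mem_diagonalSubgroup_iff.2 fun i j hij => ?_
  have h2 : (2 : K) ≠ 0 := two_ne_zero
  let a : Fin r → Kˣ := Function.update 1 i (Units.mk0 2 h2)
  refine entry_eq_zero_of_commute (coe_diagHom a) (hT.commute hg (hle ⟨a, rfl⟩)) ?_
  simp [a, Function.update_of_ne hij.symm]

end Tori

/-! ### The involution θ, the torus `S₀` and the parabolic `P₀`. -/

section Symplectic

variable (n : ℕ)

theorem fold_rev (i : Fin (2 * n)) : fold n i.rev = fold n i := by
  ext
  simp only [fold, Fin.val_rev]
  omega

theorem fold_eq_iff {i j : Fin (2 * n)} : fold n i = fold n j ↔ i = j ∨ i = j.rev := by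
  simp only [fold, Fin.ext_iff, Fin.val_rev]
  omega

theorem rev_ne (i : Fin (2 * n)) : i.rev ≠ i := by
  simp only [ne_eq, Fin.ext_iff, Fin.val_rev]
  omega

theorem fold_wPerm (i : Fin (2 * n)) : (fold n (wPerm n i) : ℕ) = i / 2 := by
  have := i.2
  simp only [fold, wPerm, Equiv.coe_fn_mk]
  split_ifs <;> simp only <;> omega

theorem fold_eq_wPerm_symm (i : Fin (2 * n)) :
    (fold n i : ℕ) = ((wPerm n).symm i : Fin (2 * n)) / 2 := by
  rw [← fold_wPerm, Equiv.apply_symm_apply]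

/-- The nonzero entry of the `i`-th column of `epsMatrix`. -/
def epsSign (R : Type*) [CommRing R] (i : Fin (2 * n)) : R :=
  if (i.rev : ℕ) < n then 1 else -1

variable {R : Type*} [CommRing R]

theorem epsSign_mul_self (i : Fin (2 * n)) : epsSign n R i * epsSign n R i = 1 := by
  unfold epsSign
  split_ifs <;> simp

theorem epsSign_rev (i : Fin (2 * n)) : epsSign n R i.rev = -epsSign n R i := by
  have : (i.rev.rev : ℕ) < n ↔ ¬ (i.rev : ℕ) < n := by
    simp only [Fin.val_rev]
    omega
  unfold epsSign
  simp only [this]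
  split_ifs <;> simp

theorem mul_epsMatrix_apply (M : Matrix (Fin (2 * n)) (Fin (2 * n)) R) (i j : Fin (2 * n)) :
    (M * epsMatrix n R) i j = M i j.rev * epsSign n R j := by
  rw [Matrix.mul_apply, Finset.sum_eq_single j.rev]
  · simp [epsMatrix, epsSign]
  · intro k _ hk
    have : j ≠ k.rev := fun h => hk (by rw [h, Fin.rev_rev])
    simp [epsMatrix, this]
  · simp

theorem transpose_epsMatrix_mul_apply (M : Matrix (Fin (2 * n)) (Fin (2 * n)) R)
    (i j : Fin (2 * n)) : ((epsMatrix n R)ᵀ * M) i j = epsSign n R i * M i.rev j := by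
  rw [← Matrix.transpose_apply ((epsMatrix n R)ᵀ * M), Matrix.transpose_mul,
    Matrix.transpose_transpose, mul_epsMatrix_apply, Matrix.transpose_apply, mul_comm]

theorem theta_apply (g : GL (Fin (2 * n)) R) (i j : Fin (2 * n)) :
    (theta n R g).1 i j = epsSign n R i * epsSign n R j * (g⁻¹).1 j.rev i.rev := by
  have : (theta n R g).1 = (epsMatrix n R)ᵀ * ((g⁻¹).1)ᵀ * epsMatrix n R := by
    simp only [theta, MonoidHom.comp_apply, MulEquiv.toMonoidHom_eq_coe, MonoidHom.coe_coe,
      MulAut.conj_apply, inv_inv]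
    rfl
  rw [this, mul_epsMatrix_apply, transpose_epsMatrix_mul_apply, Matrix.transpose_apply]
  ring

theorem theta_theta (g : GL (Fin (2 * n)) R) : theta n R (theta n R g) = g := by
  refine Units.ext ?_
  ext i j
  rw [theta_apply, ← map_inv, theta_apply, inv_inv, epsSign_rev, epsSign_rev, Fin.rev_rev,
    Fin.rev_rev]
  linear_combination (epsSign n R j * epsSign n R j * g.1 i j) * epsSign_mul_self n (R := R) i +
    g.1 i j * epsSign_mul_self n (R := R) j

theorem mem_map_theta {P : Subgroup (GL (Fin (2 * n)) R)} {g : GL (Fin (2 * n)) R} :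
    g ∈ P.map (theta n R) ↔ theta n R g ∈ P := by
  constructor
  · rintro ⟨h, hh, rfl⟩
    rwa [theta_theta]
  · exact fun h => ⟨_, h, theta_theta n g⟩

theorem mem_P₀_iff {g : GL (Fin (2 * n)) R} :
    g ∈ P₀ n R ↔ ∀ i j, (fold n j : ℕ) < fold n i → g.1 i j = 0 := by
  have key (i j : Fin (2 * n)) :
      ((wPlus n R)⁻¹ * g * wPlus n R).1 i j = g.1 (wPerm n i) (wPerm n j) := by
    have h1 : ((wPlus n R)⁻¹).1 = Matrix.of fun i j => if j = wPerm n i then 1 else 0 := rfl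
    have h2 : (wPlus n R).1 = Matrix.of fun i j => if i = wPerm n j then 1 else 0 := rfl
    rw [Units.val_mul, Units.val_mul, h1, h2]
    simp [Matrix.mul_apply]
  rw [P₀, Subgroup.mem_map_equiv, MulAut.conj_symm_apply]
  change (∀ i j : Fin (2 * n), (j : ℕ) / 2 < i / 2 → ((wPlus n R)⁻¹ * g * wPlus n R).1 i j = 0) ↔ _
  simp only [key]
  constructor
  · intro h i j hij
    rw [fold_eq_wPerm_symm, fold_eq_wPerm_symm] at hij
    simpa using h _ _ hij
  · intro h i j hij
    refine h _ _ ?_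
    rwa [fold_wPerm, fold_wPerm]

variable {K : Type*} [Field K]

theorem mem_S₀_iff {g : GL (Fin (2 * n)) K} :
    g ∈ S₀ n K ↔ (∀ i j, i ≠ j → g.1 i j = 0) ∧ ∀ i : Fin (2 * n), g.1 i i = g.1 i.rev i.rev := by
  constructor
  · rintro ⟨a, rfl⟩
    refine ⟨fun i j hij => ?_, fun i => ?_⟩
    · rw [coe_diagHom, Matrix.diagonal_apply_ne _ hij]
    · rw [coe_diagHom, Matrix.diagonal_apply_eq, Matrix.diagonal_apply_eq, fold_rev]
  · rintro ⟨h1, h2⟩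
    let ι : Fin n → Fin (2 * n) := fun k => ⟨k, by omega⟩
    refine ⟨fun k => Units.mk0 (g.1 (ι k) (ι k)) (diag_ne_zero h1 _), Units.ext ?_⟩
    ext i j
    rw [coe_diagHom]
    by_cases hij : i = j
    · subst hij
      rw [Matrix.diagonal_apply_eq, Units.val_mk0]
      have : i = ι (fold n i) ∨ i = (ι (fold n i)).rev := by
        simp only [ι, fold, Fin.ext_iff, Fin.val_rev]
        omega
      rcases this with h | h
      · rw [← h]
      · rw [h2 (ι (fold n i)), ← h]
    · rw [Matrix.diagonal_apply_ne _ hij, h1 i j hij]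

theorem map_theta_A₀ : (A₀ n K).map (theta n K) = A₀ n K := by
  have key (g : GL (Fin (2 * n)) K) (hg : g ∈ A₀ n K) : theta n K g ∈ A₀ n K := by
    refine mem_diagonalSubgroup_iff.2 fun i j hij => ?_
    rw [theta_apply, mem_diagonalSubgroup_iff.1 (inv_mem hg) _ _
      (fun h => hij (Fin.rev_injective h).symm), mul_zero]
  ext g
  rw [mem_map_theta]
  exact ⟨fun h => by simpa only [theta_theta] using key _ h, key g⟩

theorem S₀_le_A₀ : S₀ n K ≤ A₀ n K :=
  fun _ hg => mem_diagonalSubgroup_iff.2 ((mem_S₀_iff n).1 hg).1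

theorem isAlgSubgroup_S₀ (k : Type*) [Field k] [Algebra k K] : IsAlgSubgroup k (S₀ n K) := by
  have := isClosed_setOf_aeval_eq_zero (m := Fin (2 * n)) (K := K) k
    ({p | ∃ i j, i ≠ j ∧ p = MvPolynomial.X (i, j)} ∪
      {p | ∃ i : Fin (2 * n), p = MvPolynomial.X (i, i) - MvPolynomial.X (i.rev, i.rev)})
  unfold IsAlgSubgroup
  convert! this using 1
  ext g
  simp only [SetLike.mem_coe, mem_S₀_iff, Set.mem_ofPred_eq]
  constructor
  · rintro ⟨h1, h2⟩ _ (⟨i, j, hij, rfl⟩ | ⟨i, rfl⟩)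
    · rw [MvPolynomial.aeval_X]
      exact h1 i j hij
    · rw [map_sub, MvPolynomial.aeval_X, MvPolynomial.aeval_X, sub_eq_zero]
      exact h2 i
  · refine fun h => ⟨fun i j hij => ?_, fun i => ?_⟩
    · have := h _ (Or.inl ⟨i, j, hij, rfl⟩)
      rwa [MvPolynomial.aeval_X] at this
    · have := h _ (Or.inr ⟨i, rfl⟩)
      rwa [map_sub, MvPolynomial.aeval_X, MvPolynomial.aeval_X, sub_eq_zero] at this

theorem isSplitTorus_S₀ (k : Type*) [Field k] [Algebra k K] : IsSplitTorus k (S₀ n K) := by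
  let ι : Fin n → Fin (2 * n) := fun k => ⟨k, by omega⟩
  have hι (k : Fin n) : fold n (ι k) = k := by
    simp only [ι, fold, Fin.ext_iff]
    omega
  let f : (Fin n → Kˣ) →* S₀ n K :=
    { toFun := fun a => ⟨diagHom (Fin (2 * n)) K fun i => a (fold n i), a, rfl⟩
      map_one' := Subtype.ext (map_one _)
      map_mul' := fun a b => Subtype.ext (map_mul (diagHom (Fin (2 * n)) K) _ _) }
  have hf : Function.Bijective f := by
    constructor
    · intro a b hab
      have h1 := diagHom_injective (congrArg Subtype.val hab)
      funext k
      have h2 := congrFun h1 (ι k)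
      simpa only [hι] using h2
    · rintro ⟨_, a, rfl⟩
      exact ⟨a, rfl⟩
  let d : (Fin n → Kˣ) ≃* diagonalSubgroup (Fin n) K := MonoidHom.ofInjective diagHom_injective
  refine ⟨isAlgSubgroup_S₀ n k, n, (MulEquiv.ofBijective f hf).symm.trans d, fun i j => ?_,
    fun i j => ?_⟩
  · refine ⟨if i = j then MvPolynomial.X (ι i, ι i) else 0, 0, fun g => ?_⟩
    obtain ⟨a, rfl⟩ := (MulEquiv.ofBijective f hf).surjective g
    rw [MulEquiv.trans_apply, MulEquiv.symm_apply_apply]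
    change Matrix.diagonal (fun i => (a i : K)) i j = _
    by_cases hij : i = j
    · subst hij
      rw [if_pos rfl, MvPolynomial.aeval_X, pow_zero, mul_one, Matrix.diagonal_apply_eq]
      change _ = Matrix.diagonal (fun i => (a (fold n i) : K)) (ι i) (ι i)
      rw [Matrix.diagonal_apply_eq, hι]
    · rw [if_neg hij, map_zero, zero_mul, Matrix.diagonal_apply_ne _ hij]
  · refine ⟨if i = j then MvPolynomial.X (fold n i, fold n i) else 0, 0, fun g => ?_⟩
    obtain ⟨a, rfl⟩ := d.surjective g
    rw [MulEquiv.symm_trans_apply, MulEquiv.symm_symm, MulEquiv.symm_apply_apply]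
    change Matrix.diagonal (fun i => (a (fold n i) : K)) i j = _
    by_cases hij : i = j
    · subst hij
      rw [if_pos rfl, MvPolynomial.aeval_X, pow_zero, mul_one, Matrix.diagonal_apply_eq]
      change _ = Matrix.diagonal (fun i => (a i : K)) (fold n i) (fold n i)
      rw [Matrix.diagonal_apply_eq]
    · rw [if_neg hij, map_zero, zero_mul, Matrix.diagonal_apply_ne _ hij]

theorem theta_eq_inv_of_mem_S₀ {s : GL (Fin (2 * n)) K} (hs : s ∈ S₀ n K) :
    theta n K s = s⁻¹ := by
  obtain ⟨h1, h2⟩ := (mem_S₀_iff n).1 (inv_mem hs)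
  refine Units.ext ?_
  ext i j
  rw [theta_apply]
  by_cases hij : i = j
  · rw [← hij, epsSign_mul_self, one_mul, h2 i]
  · rw [h1 i j hij, h1 _ _ fun h => hij (Fin.rev_injective h).symm, mul_zero]

/-- The hypothesis on θ reads g_{ij} = ± g_{j.rev, i.rev}. At an antidiagonal place this is g_{ij} =
−g_{ij}, because ε is skew; on the diagonal it is the symmetry defining `S₀`. -/
theorem mem_S₀_of_theta_eq_inv [CharZero K] {g : GL (Fin (2 * n)) K}
    (hg : ∀ i j, fold n i ≠ fold n j → g.1 i j = 0) (hθ : theta n K g = g⁻¹) : g ∈ S₀ n K := by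
  have h (i j : Fin (2 * n)) :
      g.1 i j = epsSign n K i * epsSign n K j * g.1 j.rev i.rev := by
    have h1 := theta_apply n g⁻¹ i j
    rwa [map_inv, hθ, inv_inv] at h1
  refine (mem_S₀_iff n).2 ⟨fun i j hij => ?_, fun i => ?_⟩
  · by_cases hf : fold n i = fold n j
    · obtain rfl := ((fold_eq_iff n).1 hf).resolve_left hij
      have h1 := h j.rev j
      rw [epsSign_rev, neg_mul, epsSign_mul_self, Fin.rev_rev] at h1
      exact self_eq_neg.1 (by linear_combination h1)
    · exact hg i j hf
  · have h1 := h i i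
    rwa [epsSign_mul_self, one_mul] at h1

/-- A larger torus centralizes `S₀`, hence is block diagonal, and θ-splitness then makes its blocks
scalar. -/
theorem maximal_isThetaSplitTorus_S₀ (k : Type*) [Field k] [Algebra k K] [CharZero K] :
    Maximal (IsThetaSplitTorus k (theta n K)) (S₀ n K) := by
  refine ⟨⟨isSplitTorus_S₀ n k, fun s hs => theta_eq_inv_of_mem_S₀ n hs⟩,
    fun T hT hle g hg => mem_S₀_of_theta_eq_inv n (fun i j hij => ?_) (hT.2 g hg)⟩
  have h2 : (2 : K) ≠ 0 := two_ne_zero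
  let a : Fin n → Kˣ := Function.update 1 (fold n i) (Units.mk0 2 h2)
  refine entry_eq_zero_of_commute (coe_diagHom fun i => a (fold n i))
    (hT.1.commute hg (hle ⟨a, rfl⟩)) ?_
  simp [a, Function.update_of_ne hij.symm]

theorem coe_map_algebraMap {k : Type*} [Field k] [Algebra k K] {m : Type*} [Fintype m]
    [DecidableEq m] (g : GL m k) (i j : m) :
    (GeneralLinearGroup.map (algebraMap k K) g).1 i j = algebraMap k K (g.1 i j) :=
  rfl

theorem mem_rationalPoints {k : Type*} [Field k] [Algebra k K] {m : Type*} [Fintype m]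
    [DecidableEq m] {H : Subgroup (GL m K)} {g : GL m k} :
    g ∈ rationalPoints k H ↔ GeneralLinearGroup.map (algebraMap k K) g ∈ H :=
  Iff.rfl

theorem rationalPoints_A₀ (k : Type*) [Field k] [Algebra k K] :
    rationalPoints k (A₀ n K) = A₀ n k := by
  ext g
  simp only [mem_rationalPoints, A₀, mem_diagonalSubgroup_iff, coe_map_algebraMap,
    map_eq_zero]

theorem rationalPoints_S₀ (k : Type*) [Field k] [Algebra k K] :
    rationalPoints k (S₀ n K) = S₀ n k := by
  ext g
  simp only [mem_rationalPoints, mem_S₀_iff, coe_map_algebraMap, map_eq_zero,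
    (algebraMap k K).injective.eq_iff]

theorem rationalPoints_P₀ (k : Type*) [Field k] [Algebra k K] :
    rationalPoints k (P₀ n K) = P₀ n k := by
  ext g
  simp only [mem_rationalPoints, mem_P₀_iff, coe_map_algebraMap, map_eq_zero]

theorem P₀_eq_stabChain : P₀ n K = stabChain (coordChain K fun i => (fold n i : ℕ)) := by
  ext g
  rw [mem_P₀_iff, mem_stabChain_coordChain]

/-- Transposition reverses the block order while `Fin.rev` preserves each block, so the image is the
stabilizer for the reversed grading. -/
theorem map_theta_P₀ :
    (P₀ n K).map (theta n K) = stabChain (coordChain K fun i => n - 1 - (fold n i : ℕ)) := by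
  ext g
  rw [mem_map_theta, mem_P₀_iff, ← inv_mem_iff, mem_stabChain_coordChain]
  have hlt (i : Fin (2 * n)) := (fold n i).2
  have hsgn (i : Fin (2 * n)) : epsSign n K i ≠ 0 := fun h => by
    simpa [h] using epsSign_mul_self n (R := K) i
  constructor
  · intro h i j hij
    have h1 := h j.rev i.rev (by
      rw [fold_rev, fold_rev]
      have := hlt i
      have := hlt j
      omega)
    rw [theta_apply, Fin.rev_rev, Fin.rev_rev] at h1
    exact (mul_eq_zero.1 h1).resolve_left (mul_ne_zero (hsgn _) (hsgn _))
  · intro h i j hij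
    rw [theta_apply, h _ _ (by
      rw [fold_rev, fold_rev]
      have := hlt i
      have := hlt j
      omega), mul_zero]

theorem mem_P₀_inf_map_theta {g : GL (Fin (2 * n)) K} :
    g ∈ P₀ n K ⊓ (P₀ n K).map (theta n K) ↔ ∀ i j, fold n i ≠ fold n j → g.1 i j = 0 := by
  rw [map_theta_P₀, P₀_eq_stabChain, Subgroup.mem_inf, mem_stabChain_coordChain,
    mem_stabChain_coordChain]
  have hlt (i : Fin (2 * n)) := (fold n i).2
  constructor
  · rintro ⟨h1, h2⟩ i j hij
    rcases lt_or_gt_of_ne (fun h => hij (Fin.ext h)) with h | h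
    · exact h2 i j (by have := hlt i; have := hlt j; omega)
    · exact h1 i j h
  · exact fun h => ⟨fun i j hij => h i j (by rintro h; rw [h] at hij; omega),
      fun i j hij => h i j (by rintro h; rw [h] at hij; omega)⟩

theorem areOpposite_P₀ [Infinite K] : AreOpposite (P₀ n K) ((P₀ n K).map (theta n K)) := by
  constructor
  · generalize hL : P₀ n K ⊓ (P₀ n K).map (theta n K) = L
    rw [P₀_eq_stabChain]
    subst hL
    refine isLevi_blockDiagonal fun g => (mem_P₀_inf_map_theta n).trans ?_
    simp only [ne_eq, Fin.ext_iff]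
  · generalize hL : P₀ n K ⊓ (P₀ n K).map (theta n K) = L
    rw [map_theta_P₀]
    subst hL
    refine isLevi_blockDiagonal fun g => (mem_P₀_inf_map_theta n).trans ?_
    have (i j : Fin (2 * n)) : n - 1 - (fold n i : ℕ) ≠ n - 1 - (fold n j : ℕ) ↔
        fold n i ≠ fold n j := by
      have := (fold n i).2
      have := (fold n j).2
      rw [ne_eq, ne_eq, Fin.ext_iff]
      omega
    simp only [this]

theorem isParabolic_P₀ (k : Type*) [Field k] [Algebra k K] [IsAlgClosed K] [CharZero K] :
    IsParabolic k (P₀ n K) := by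
  constructor
  · have := isClosed_setOf_aeval_eq_zero (m := Fin (2 * n)) (K := K) k
      {p | ∃ i j, (fold n j : ℕ) < fold n i ∧ p = MvPolynomial.X (i, j)}
    unfold IsAlgSubgroup
    convert! this using 1
    ext g
    simp only [SetLike.mem_coe, mem_P₀_iff, Set.mem_ofPred_eq]
    constructor
    · rintro h _ ⟨i, j, hij, rfl⟩
      rw [MvPolynomial.aeval_X]
      exact h i j hij
    · intro h i j hij
      have := h _ ⟨i, j, hij, rfl⟩
      rwa [MvPolynomial.aeval_X] at this
  -- The enumeration inverse to `wPerm` lists the two indices of each block consecutively, so its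
  -- flag refines the block chain.
  · refine ⟨_, isBorel_stabChain (isFullFlag_coordChain
      (σ := fun i => ((wPerm n).symm i : ℕ))
      (fun i j hij => (wPerm n).symm.injective (Fin.ext hij)) fun j => ?_), fun g hg => ?_⟩
    · rw [Fintype.card_fin]
      exact Fin.is_lt _
    · refine (mem_P₀_iff n).2 fun i j hij => mem_stabChain_coordChain.1 hg i j ?_
      rw [fold_eq_wPerm_symm, fold_eq_wPerm_symm] at hij
      exact lt_of_not_ge fun h => absurd hij (not_lt.2 (Nat.div_le_div_right h))

theorem isThetaSplitParabolic_P₀ (k : Type*) [Field k] [Algebra k K] [IsAlgClosed K]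
    [CharZero K] : IsThetaSplitParabolic k (theta n K) (P₀ n K) :=
  ⟨isParabolic_P₀ n k, areOpposite_P₀ n⟩

end Symplectic

/-! ### Minimality of `P₀`: planes, alternating forms and transvections. -/

section Minimality

variable (n : ℕ) {K : Type*} [Field K]

/-- The chain of coordinate subspaces stabilized by `P₀`. -/
def foldChain (K : Type*) [Field K] : ℕ → Submodule K (Fin (2 * n) → K) :=
  coordChain K fun i => (fold n i : ℕ)

theorem foldChain_mono : Monotone (foldChain n K) :=
  coordChain_mono _

theorem foldChain_top {k : ℕ} (hk : n ≤ k) : foldChain n K k = ⊤ :=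
  coordChain_top fun i => (fold n i).2.trans_le hk

theorem finrank_foldChain {k : ℕ} (hk : k ≤ n) : Module.finrank K (foldChain n K k) = 2 * k := by
  have hflag : IsFullFlag (coordChain K fun i => ((wPerm n).symm i : ℕ)) :=
    isFullFlag_coordChain (fun i j hij => (wPerm n).symm.injective (Fin.ext hij)) fun j => by
      rw [Fintype.card_fin]
      exact Fin.is_lt _
  have h : foldChain n K k = coordChain K (fun i => ((wPerm n).symm i : ℕ)) (2 * k) := by
    ext v
    refine forall_congr' fun j => ?_
    beta_reduce
    rw [fold_eq_wPerm_symm]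
    have : k ≤ ((wPerm n).symm j : ℕ) / 2 ↔ 2 * k ≤ ((wPerm n).symm j : ℕ) := by omega
    rw [this]
  rw [h, hflag.finrank_eq]
  rw [Fintype.card_fin]
  omega

/-- A subspace stable under the flag stabilizer is a member of the flag, and its dimension tells
which one. -/
theorem foldChain_eq_of_isFullFlag [CharZero K] {W : ℕ → Submodule K (Fin (2 * n) → K)}
    (hW : IsFullFlag W) (hle : stabChain W ≤ stabChain (foldChain n K)) (k : ℕ) :
    foldChain n K k = W (2 * k) := by
  rcases le_total k n with hk | hk
  · obtain ⟨i, hi, h⟩ := hW.eq_of_stable fun g hg v hv => hle hg k v hv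
    have h1 := finrank_foldChain n (K := K) hk
    rw [h, hW.finrank_eq hi] at h1
    rw [h, h1]
  · rw [foldChain_top n hk, eq_comm, ← top_le_iff, ← hW.top]
    refine hW.mono ?_
    rw [Fintype.card_fin]
    omega

variable {n}

/-- The alternating form on the coordinates `p` and `p.rev`. -/
def pairForm (p : Fin (2 * n)) (z v : Fin (2 * n) → K) : K :=
  z p * v p.rev - z p.rev * v p

/-- The form is alternating, so the determinant 1 + t · `pairForm p z z` is 1. -/
theorem exists_pairTransvection (p : Fin (2 * n)) (z : Fin (2 * n) → K) (t : K) :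
    ∃ τ : GL (Fin (2 * n)) K, ∀ v, τ.1 *ᵥ v = v + (t * pairForm p z v) • z := by
  let φ : Fin (2 * n) → K := Pi.single p.rev (z p) - Pi.single p (z p.rev)
  have hφ (v : Fin (2 * n) → K) : φ ⬝ᵥ v = pairForm p z v := by
    simp [φ, pairForm, sub_dotProduct]
  obtain ⟨τ, hτ⟩ := exists_GL_one_add_vecMulVec (v := t • z) (φ := φ) (by
    rw [dotProduct_smul, hφ, pairForm, mul_comm, sub_self, smul_zero, add_zero]
    exact one_ne_zero)
  refine ⟨τ, fun v => ?_⟩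
  rw [hτ, one_add_vecMulVec_mulVec, hφ, smul_smul, mul_comm t]

theorem pairForm_add_smul (p : Fin (2 * n)) (z v w : Fin (2 * n) → K) (a : K) :
    pairForm p z (v + a • w) = pairForm p z v + a * pairForm p z w := by
  simp only [pairForm, Pi.add_apply, Pi.smul_apply, smul_eq_mul]
  ring

theorem pairForm_self (p : Fin (2 * n)) (z : Fin (2 * n) → K) : pairForm p z z = 0 := by
  rw [pairForm, mul_comm, sub_self]

theorem pairForm_swap (p : Fin (2 * n)) (z v : Fin (2 * n) → K) :
    pairForm p z v = -pairForm p v z := by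
  rw [pairForm, pairForm]
  ring

theorem mem_foldChain_iff {p : Fin (2 * n)} {v : Fin (2 * n) → K}
    (hv : v ∈ foldChain n K (fold n p + 1)) :
    v ∈ foldChain n K (fold n p) ↔ v p = 0 ∧ v p.rev = 0 := by
  constructor
  · exact fun h => ⟨h p le_rfl, h p.rev (by beta_reduce; rw [fold_rev])⟩
  · rintro ⟨h1, h2⟩ j hj
    rcases hj.lt_or_eq with h | h
    · exact hv j h
    · rcases (fold_eq_iff n).1 (Fin.ext h.symm) with rfl | rfl
      exacts [h1, h2]

theorem pairForm_eq_zero {p : Fin (2 * n)} {v : Fin (2 * n) → K}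
    (hv : v ∈ foldChain n K (fold n p)) (z : Fin (2 * n) → K) : pairForm p z v = 0 := by
  obtain ⟨h1, h2⟩ := (mem_foldChain_iff (foldChain_mono n (Nat.le_succ _) hv)).1 hv
  rw [pairForm, h1, h2, mul_zero, mul_zero, sub_zero]

/-- The form is nondegenerate on the plane of the block of p, so orthogonal to x means proportional
to x there. -/
theorem exists_sub_smul_mem {p : Fin (2 * n)} {x v : Fin (2 * n) → K}
    (hx : x ∈ foldChain n K (fold n p + 1)) (hx' : x ∉ foldChain n K (fold n p))
    (hv : v ∈ foldChain n K (fold n p + 1)) (h : pairForm p x v = 0) :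
    ∃ c : K, v - c • x ∈ foldChain n K (fold n p) := by
  have hmem (c : K) : v - c • x ∈ foldChain n K (fold n p) ↔
      v p - c * x p = 0 ∧ v p.rev - c * x p.rev = 0 :=
    mem_foldChain_iff (sub_mem hv (Submodule.smul_mem _ _ hx))
  simp only [hmem]
  rw [pairForm] at h
  by_cases h0 : x p = 0
  · have h1 : x p.rev ≠ 0 := fun h1 => hx' ((mem_foldChain_iff hx).2 ⟨h0, h1⟩)
    refine ⟨v p.rev / x p.rev, ?_, by field_simp; ring⟩
    rw [h0, zero_mul, zero_sub, neg_eq_zero] at h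
    rw [(mul_eq_zero.1 h).resolve_left h1, h0, mul_zero, sub_zero]
  · refine ⟨v p / x p, by field_simp; ring, ?_⟩
    field_simp
    linear_combination h

/-! ### Groups between the stabilizer of a refining full flag and `P₀`. -/

section Flag

variable {W : ℕ → Submodule K (Fin (2 * n) → K)} (hW : IsFullFlag W)
  (hE : ∀ k, foldChain n K k = W (2 * k))

include hW in
theorem IsFullFlag.exists_sub_smul_mem {k : ℕ} {x v : Fin (2 * n) → K} (hx : x ∈ W (k + 1))
    (hx' : x ∉ W k) (hv : v ∈ W (k + 1)) : ∃ c : K, v - c • x ∈ W k := by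
  obtain ⟨e, -, he⟩ := hW.step k
  obtain ⟨w, hw, z, hz, rfl⟩ := Submodule.mem_sup.1 (he hx)
  obtain ⟨a, rfl⟩ := Submodule.mem_span_singleton.1 hz
  obtain ⟨w', hw', z', hz', rfl⟩ := Submodule.mem_sup.1 (he hv)
  obtain ⟨a', rfl⟩ := Submodule.mem_span_singleton.1 hz'
  have ha : a ≠ 0 := by
    rintro rfl
    exact hx' (by simpa using hw)
  refine ⟨a' / a, ?_⟩
  have : w' + a' • e - (a' / a) • (w + a • e) = w' - (a' / a) • w := by
    rw [smul_add, smul_smul, div_mul_cancel₀ _ ha]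
    abel
  rw [this]
  exact sub_mem hw' (Submodule.smul_mem _ _ hw)

include hW in
theorem IsFullFlag.exists_mem_notMem {k : ℕ} (hk : k < 2 * n) : ∃ x ∈ W (k + 1), x ∉ W k := by
  by_contra! h
  have h1 := Submodule.finrank_mono (show W (k + 1) ≤ W k from h)
  have h2 : 2 * n = Fintype.card (Fin (2 * n)) := (Fintype.card_fin _).symm
  rw [hW.finrank_eq (by omega), hW.finrank_eq (by omega)] at h1
  omega

include hE in
theorem mem_stabChain_of_odd {g : GL (Fin (2 * n)) K} (hg : g ∈ stabChain (foldChain n K))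
    (h : ∀ k, ∀ v ∈ W (2 * k + 1), g.1 *ᵥ v ∈ W (2 * k + 1)) : g ∈ stabChain W := by
  intro l v hv
  obtain ⟨k, rfl | rfl⟩ := Nat.even_or_odd' l
  · rw [← hE] at hv ⊢
    exact hg k v hv
  · exact h k v hv

include hW hE in
-- A scalar on each plane preserves every line in it, whichever flag refines the chain.
theorem mem_stabChain_of_scalar {g : GL (Fin (2 * n)) K} (hg : g ∈ stabChain (foldChain n K))
    (h : ∀ k, ∃ c : K, ∀ v ∈ foldChain n K (k + 1), g.1 *ᵥ v - c • v ∈ foldChain n K k) :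
    g ∈ stabChain W := by
  refine mem_stabChain_of_odd hE hg fun k v hv => ?_
  obtain ⟨c, hc⟩ := h k
  have h1 := hc v (by rw [hE]; exact hW.mono (by omega) hv)
  rw [hE] at h1
  have h2 := add_mem (hW.mono (Nat.le_succ _) h1) (Submodule.smul_mem _ c hv)
  rwa [sub_add_cancel] at h2

include hW hE in
theorem S₀_le_stabChain : S₀ n K ≤ stabChain W := by
  rintro _ ⟨a, rfl⟩
  have hmul (v : Fin (2 * n) → K) (j : Fin (2 * n)) :
      ((diagHom (Fin (2 * n)) K fun i => a (fold n i)).1 *ᵥ v) j = a (fold n j) * v j := by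
    rw [coe_diagHom, Matrix.mulVec_diagonal]
  refine mem_stabChain_of_scalar hW hE (fun k v hv j hj => ?_) fun k => ?_
  · rw [hmul, hv j hj, mul_zero]
  · by_cases hk : k < n
    · refine ⟨a ⟨k, hk⟩, fun v hv j hj => ?_⟩
      rw [Pi.sub_apply, hmul, Pi.smul_apply, smul_eq_mul]
      rcases hj.lt_or_eq with h | h
      · rw [hv j h, mul_zero, mul_zero, sub_zero]
      · have : fold n j = ⟨k, hk⟩ := Fin.ext h.symm
        rw [this, sub_self]
    · exact ⟨0, fun v _ => by rw [foldChain_top n (not_lt.1 hk)]; trivial⟩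

include hW hE in
-- The conjugate sends v to v + c(v) x, where c kills everything below the plane of p; members of W
-- beyond that point contain x. Hence Q contains the transvections along every Q-translate of the
-- flag's line (`pairTransvection_mem`).
theorem conj_pairTransvection_mem_stabChain {p : Fin (2 * n)} {x : Fin (2 * n) → K}
    (hx : x ∈ W (2 * fold n p + 1)) {g τ : GL (Fin (2 * n)) K}
    (hg : g ∈ stabChain (foldChain n K)) {t : K}
    (hτ : ∀ v, τ.1 *ᵥ v = v + (t * pairForm p (g.1 *ᵥ x) v) • (g.1 *ᵥ x)) :
    g⁻¹ * τ * g ∈ stabChain W := by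
  intro l v hv
  rw [mul_mulVec, mul_mulVec, hτ, Matrix.mulVec_add, Matrix.mulVec_smul, inv_mulVec_mulVec,
    inv_mulVec_mulVec]
  rcases le_or_gt l (2 * fold n p) with hl | hl
  · have h1 : v ∈ foldChain n K (fold n p) := by
      rw [hE]
      exact hW.mono hl hv
    rw [pairForm_eq_zero (hg _ v h1), mul_zero, zero_smul, add_zero]
    exact hv
  · exact add_mem hv (Submodule.smul_mem _ _ (hW.mono hl hx))

variable {Q : Subgroup (GL (Fin (2 * n)) K)} (hQ : Q ≤ stabChain (foldChain n K))
  (hWQ : stabChain W ≤ Q)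

include hW hE hQ hWQ in
theorem pairTransvection_mem {p : Fin (2 * n)} {x : Fin (2 * n) → K}
    (hx : x ∈ W (2 * fold n p + 1)) {g τ : GL (Fin (2 * n)) K} (hg : g ∈ Q) {t : K}
    (hτ : ∀ v, τ.1 *ᵥ v = v + (t * pairForm p (g.1 *ᵥ x) v) • (g.1 *ᵥ x)) : τ ∈ Q := by
  have h := hWQ (conj_pairTransvection_mem_stabChain hW hE hx (hQ hg) hτ)
  have h1 := mul_mem (mul_mem hg h) (inv_mem hg)
  simpa [mul_assoc] using h1

theorem pairTransvection_sub_mem {p : Fin (2 * n)} {z : Fin (2 * n) → K}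
    (hz : z ∈ foldChain n K (fold n p + 1)) {τ : GL (Fin (2 * n)) K} {t : K}
    (hτ : ∀ v, τ.1 *ᵥ v = v + (t * pairForm p z v) • z) {k : ℕ} (hk : k ≠ fold n p)
    {v : Fin (2 * n) → K} (hv : v ∈ foldChain n K (k + 1)) :
    τ.1 *ᵥ v - v ∈ foldChain n K k := by
  rw [hτ, add_sub_cancel_left]
  rcases lt_or_gt_of_ne hk with h | h
  · rw [pairForm_eq_zero (foldChain_mono n h hv), mul_zero, zero_smul]
    exact zero_mem _
  · exact Submodule.smul_mem _ _ (foldChain_mono n h hz)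

include hW hE hQ hWQ in
/-- If `Q` moves the line of the flag in the block of `p`, it moves every line of this block to
it, acting trivially on the other blocks. -/
theorem exists_mulVec_mem_of_moves {p : Fin (2 * n)} {g₀ : GL (Fin (2 * n)) K} (hg₀ : g₀ ∈ Q)
    {y₀ : Fin (2 * n) → K} (hy₀ : y₀ ∈ W (2 * fold n p + 1))
    (hg₀y₀ : g₀.1 *ᵥ y₀ ∉ W (2 * fold n p + 1)) {z : Fin (2 * n) → K}
    (hz : z ∈ foldChain n K (fold n p + 1)) :
    ∃ h ∈ Q, h.1 *ᵥ z ∈ W (2 * fold n p + 1) ∧ ∀ k : ℕ, k ≠ fold n p →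
      ∀ v ∈ foldChain n K (k + 1), h.1 *ᵥ v - v ∈ foldChain n K k := by
  have hle1 : foldChain n K (fold n p) ≤ W (2 * fold n p + 1) := by
    rw [hE]
    exact hW.mono (Nat.le_succ _)
  have hle2 : W (2 * fold n p + 1) ≤ foldChain n K (fold n p + 1) := by
    rw [hE]
    exact hW.mono (by omega)
  have hy₀' : y₀ ∉ foldChain n K (fold n p) := fun h => hg₀y₀ (hle1 (hQ hg₀ _ _ h))
  set y := g₀.1 *ᵥ y₀
  have hyE : y ∈ foldChain n K (fold n p + 1) := hQ hg₀ _ _ (hle2 hy₀)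
  have hmem {v : Fin (2 * n) → K} (hv : v ∈ foldChain n K (fold n p + 1))
      (h0 : pairForm p y₀ v = 0) : v ∈ W (2 * fold n p + 1) := by
    obtain ⟨c, hc⟩ := exists_sub_smul_mem (hle2 hy₀) hy₀' hv h0
    have := add_mem (hle1 hc) (Submodule.smul_mem _ c hy₀)
    rwa [sub_add_cancel] at this
  -- So y₀ and y give a basis of the plane, and Q contains transvections along both.
  have hδ : pairForm p y₀ y ≠ 0 := fun h => hg₀y₀ (hmem hyE h)
  have hstep {z : Fin (2 * n) → K} (hz : z ∈ foldChain n K (fold n p + 1))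
      (h0 : pairForm p y z ≠ 0) : ∃ h ∈ Q, h.1 *ᵥ z ∈ W (2 * fold n p + 1) ∧
      ∀ k : ℕ, k ≠ fold n p → ∀ v ∈ foldChain n K (k + 1), h.1 *ᵥ v - v ∈ foldChain n K k := by
    -- The coefficient solves `pairForm p y₀ (τ z) = 0`, that is, τ z falls in the line of y₀.
    obtain ⟨τ, hτ⟩ := exists_pairTransvection p y
      (-pairForm p y₀ z / (pairForm p y z * pairForm p y₀ y))
    refine ⟨τ, pairTransvection_mem hW hE hQ hWQ hy₀ hg₀ hτ, ?_, fun k hk v hv =>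
      pairTransvection_sub_mem hyE hτ hk hv⟩
    rw [hτ]
    refine hmem (add_mem hz (Submodule.smul_mem _ _ hyE)) ?_
    rw [pairForm_add_smul]
    field_simp
    ring
  by_cases h1 : pairForm p y₀ z = 0
  · exact ⟨1, one_mem _, by simpa using hmem hz h1, fun k _ v _ => by simp⟩
  by_cases h2 : pairForm p y z = 0
  -- When z is proportional to y in the plane, a transvection along y₀ first moves it off that line.
  · obtain ⟨τ, hτ⟩ := exists_pairTransvection p y₀ 1
    have hτQ : τ ∈ Q := pairTransvection_mem hW hE hQ hWQ hy₀ (one_mem Q) (t := 1)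
      (by simpa using hτ)
    obtain ⟨h, hh, hhz, hhk⟩ := hstep (z := τ.1 *ᵥ z) (hQ hτQ _ _ hz) (by
      rw [hτ, pairForm_add_smul, h2, zero_add, one_mul, pairForm_swap p y]
      exact mul_ne_zero h1 (neg_ne_zero.2 hδ))
    refine ⟨h * τ, mul_mem hh hτQ, by rwa [mul_mulVec], fun k hk v hv => ?_⟩
    have h3 := pairTransvection_sub_mem (hle2 hy₀) hτ hk hv
    have h4 := add_mem (hQ hh k _ h3) (hhk k hk v hv)
    rwa [Matrix.mulVec_sub, sub_add_sub_cancel, ← mul_mulVec] at h4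
  · exact hstep hz h2

include hW hE hQ hWQ in
-- Given g in the larger stabilizer, left multiplication by elements of Q brings the displaced lines
-- back one plane at a time. Each correction acts trivially on the other planes, so earlier ones
-- survive; the corrected element preserves W and lies in Q.
theorem stabChain_foldChain_le_of_moves (hmv : ∀ p : Fin (2 * n), ∃ g ∈ Q,
    ∃ v ∈ W (2 * fold n p + 1), g.1 *ᵥ v ∉ W (2 * fold n p + 1)) :
    stabChain (foldChain n K) ≤ Q := by
  intro g hg
  have key (j : ℕ) (hj : j ≤ n) : ∃ h ∈ Q, ∀ k < j, ∀ v ∈ W (2 * k + 1),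
      (h * g).1 *ᵥ v ∈ W (2 * k + 1) := by
    induction j with
    | zero => exact ⟨1, one_mem _, fun k hk => absurd hk (Nat.not_lt_zero k)⟩
    | succ j ih =>
      obtain ⟨h₀, hh₀, ih⟩ := ih (Nat.le_of_succ_le hj)
      obtain ⟨p, hp⟩ : ∃ p : Fin (2 * n), (fold n p : ℕ) = j :=
        ⟨⟨j, by omega⟩, by simp only [fold]; omega⟩
      obtain ⟨g₁, hg₁, y, hy, hgy⟩ := hmv p
      obtain ⟨x, hx, hx'⟩ := hW.exists_mem_notMem (show 2 * j < 2 * n by omega)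
      have hst := mul_mem (hQ hh₀) hg
      obtain ⟨h, hh, hhx, hhk⟩ := exists_mulVec_mem_of_moves hW hE hQ hWQ hg₁ hy hgy
        (z := (h₀ * g).1 *ᵥ x) (hst _ _ (by rw [hE, hp]; exact hW.mono (by omega) hx))
      rw [hp] at hhx hhk
      refine ⟨h * h₀, mul_mem hh hh₀, fun k hk v hv => ?_⟩
      rw [mul_assoc, mul_mulVec]
      rcases (Nat.lt_succ_iff.1 hk).lt_or_eq with hkj | rfl
      · have h1 := ih k hkj v hv
        have h2 := hhk k hkj.ne _ (by rw [hE]; exact hW.mono (by omega) h1)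
        rw [hE] at h2
        have h3 := add_mem (hW.mono (Nat.le_succ _) h2) h1
        rwa [sub_add_cancel] at h3
      · obtain ⟨c, hc⟩ := hW.exists_sub_smul_mem hx hx' hv
        rw [← hE] at hc
        have h1 := hQ hh _ _ (hst _ _ hc)
        rw [hE] at h1
        have h2 := add_mem (hW.mono (Nat.le_succ _) h1) (Submodule.smul_mem _ c hhx)
        rwa [Matrix.mulVec_sub, Matrix.mulVec_sub, Matrix.mulVec_smul, Matrix.mulVec_smul,
          sub_add_cancel] at h2
  obtain ⟨h, hh, hk⟩ := key n le_rfl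
  have h1 : h * g ∈ stabChain W := by
    refine mem_stabChain_of_odd hE (mul_mem (hQ hh) hg) fun k v hv => ?_
    rcases lt_or_ge k n with hkn | hkn
    · exact hk k hkn v hv
    · have : W (2 * k + 1) = ⊤ := by
        rw [← top_le_iff, ← hW.top]
        refine hW.mono ?_
        rw [Fintype.card_fin]
        omega
      rw [this]
      trivial
  have h2 := mul_mem (inv_mem hh) (hWQ h1)
  rwa [inv_mul_cancel_left] at h2

include hW hE hQ hWQ in
/-- If `Q` preserves the line of the flag in the block of `p`, its unipotent radical contains a
nontrivial block diagonal element. -/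
theorem exists_unipotentRadical_blockDiagonal [Infinite K] {p : Fin (2 * n)}
    (hfix : ∀ g ∈ Q, ∀ v ∈ W (2 * fold n p + 1), g.1 *ᵥ v ∈ W (2 * fold n p + 1)) :
    ∃ τ ∈ Q, τ ∈ unipotentRadical Q ∧ τ ≠ 1 ∧
      ∀ i j, fold n i ≠ fold n j → τ.1 i j = 0 := by
  set i : ℕ := (fold n p : ℕ) with hi
  have hin : i < n := (fold n p).2
  -- The chain C keeps the even members of W and only the odd member 2i + 1; repeating the preceding
  -- even member elsewhere makes depth 1 mean trivial action on the other planes.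
  let r : ℕ → ℕ := fun k => if k = 2 * i + 1 then k else 2 * (k / 2)
  have hr : Monotone r := by
    intro k l hkl
    simp only [r]
    split_ifs <;> omega
  let C : ℕ → Submodule K (Fin (2 * n) → K) := fun k => W (r k)
  have hCmono : Monotone C := hW.mono.comp hr
  have hCeven (k : ℕ) : C (2 * k) = W (2 * k) := by
    have : r (2 * k) = 2 * k := by simp only [r]; split_ifs <;> omega
    simp only [C, this]
  have hCi : C (2 * i + 1) = W (2 * i + 1) := by simp only [C, r, if_true]
  have hCodd (k : ℕ) (hk : k ≠ i) : C (2 * k + 1) = W (2 * k) := by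
    have : r (2 * k + 1) = 2 * k := by simp only [r]; split_ifs <;> omega
    simp only [C, this]
  have hQC : Q ≤ stabChain C := by
    intro g hg k v hv
    obtain ⟨k, rfl | rfl⟩ := Nat.even_or_odd' k
    · rw [hCeven, ← hE] at hv ⊢
      exact hQ hg k v hv
    · by_cases hk : k = i
      · rw [hk, hCi] at hv ⊢
        exact hfix g hg v hv
      · rw [hCodd k hk, ← hE] at hv ⊢
        exact hQ hg k v hv
  have hNQ : depthChain 1 C ≤ Q := by
    intro g hg
    refine hWQ (mem_stabChain_of_odd hE (fun k v hv => ?_) fun k v hv => ?_)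
    · rw [hE, ← hCeven] at hv ⊢
      exact hg.1 _ v hv
    · by_cases hk : k = i
      · rw [hk, ← hCi] at hv ⊢
        exact hg.1 _ v hv
      · have h1 : v ∈ C (2 * k + 1 + 1) := by
          rw [show 2 * k + 1 + 1 = 2 * (k + 1) by ring, hCeven]
          exact hW.mono (by omega) hv
        have h2 := hg.2 _ v h1
        rw [hCodd k hk] at h2
        have h3 := add_mem (hW.mono (Nat.le_succ _) h2) hv
        rwa [sub_add_cancel] at h3
  have hC0 : C 0 = ⊥ := by rw [← hW.zero]; exact hCeven 0
  have hCN : C (2 * n) = ⊤ := by rw [hCeven, ← hW.top, Fintype.card_fin]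
  have hNR : depthChain 1 C ≤ unipotentRadical Q :=
    le_sSup ⟨hNQ, isAlgSubgroup_depthChain _ _, isZariskiConnected_depthChain _ _,
      le_normalizer_of_conj_mem fun g hg u hu => conj_mem_depthChain (hQC hg) hu,
      fun u hu => isNilpotent_sub_one_of_mem_depthChain hC0 hCN hu⟩
  obtain ⟨x₀, hx₀, hx₀'⟩ := hW.exists_mem_notMem (show 2 * i < 2 * n by omega)
  have hx₀E : x₀ ∈ foldChain n K (i + 1) := by
    rw [hE]
    exact hW.mono (by omega) hx₀
  -- Cutting x₀ down to the coordinates of the block changes it only modulo E_i and makes the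
  -- transvection along x block diagonal.
  let x : Fin (2 * n) → K := fun j => if fold n j = fold n p then x₀ j else 0
  have hxx₀ : x₀ - x ∈ foldChain n K i := by
    intro j hj
    rw [Pi.sub_apply]
    rcases hj.lt_or_eq with h | h
    · have : fold n j ≠ fold n p := fun h' => h.ne' (congrArg Fin.val h')
      rw [hx₀E j h]
      simp only [x, if_neg this, sub_zero]
    · have : fold n j = fold n p := Fin.ext h.symm
      simp only [x, if_pos this, sub_self]
  have hx' : x ∉ W (2 * i) := by
    intro h
    rw [← hE] at h
    have h1 := add_mem hxx₀ h
    rw [sub_add_cancel, hE] at h1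
    exact hx₀' h1
  have hx : x ∈ W (2 * i + 1) := by
    rw [hE] at hxx₀
    have h1 := sub_mem hx₀ (hW.mono (Nat.le_succ _) hxx₀)
    rwa [sub_sub_cancel] at h1
  have hxE : x ∈ foldChain n K (i + 1) := by
    rw [hE]
    exact hW.mono (by omega) hx
  obtain ⟨τ, hτ⟩ := exists_pairTransvection p x 1
  have hτ0 (v : Fin (2 * n) → K) (hv : v ∈ W (2 * i)) : τ.1 *ᵥ v = v := by
    rw [← hE] at hv
    rw [hτ, pairForm_eq_zero hv, mul_zero, zero_smul, add_zero]
  have hτN : τ ∈ depthChain 1 C := by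
    refine ⟨fun k v hv => ?_, fun k v hv => ?_⟩
    · rcases le_or_gt k (2 * i) with hk | hk
      · rw [hτ0 v (by rw [← hCeven]; exact hCmono hk hv)]
        exact hv
      · rw [hτ]
        exact add_mem hv (Submodule.smul_mem _ _ (hCmono hk (by rwa [hCi])))
    -- Below the line τ is the identity; on the line it is the identity because the form vanishes at
    -- (x, x); above it, τ moves vectors by multiples of x.
    · rcases lt_trichotomy k (2 * i) with hk | rfl | hk
      · rw [hτ0 v (by rw [← hCeven]; exact hCmono hk hv), sub_self]
        exact zero_mem _
      · rw [hCi] at hv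
        obtain ⟨c, hc⟩ := hW.exists_sub_smul_mem hx hx' hv
        have h1 := hτ0 _ hc
        rw [Matrix.mulVec_sub, Matrix.mulVec_smul, hτ x, pairForm_self, mul_zero, zero_smul,
          add_zero, sub_left_inj] at h1
        rw [h1, sub_self]
        exact zero_mem _
      · rw [hτ, add_sub_cancel_left]
        exact Submodule.smul_mem _ _ (hCmono hk (by rwa [hCi]))
  have hentry (j l : Fin (2 * n)) :
      τ.1 j l = (Pi.single l 1 : Fin (2 * n) → K) j + pairForm p x (Pi.single l 1) * x j := by
    have h1 := congrFun (hτ (Pi.single l 1)) j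
    rw [Matrix.mulVec_single_one, one_mul] at h1
    exact h1
  refine ⟨τ, hNQ hτN, hNR hτN, fun h1 => hx' ?_, fun j l hjl => ?_⟩
  -- Testing on the two basis vectors of the block gives the squares of both coordinates of x, so τ
  -- = 1 would put x in E_i.
  · have h2 (v : Fin (2 * n) → K) : pairForm p x v • x = 0 := by
      have := hτ v
      rw [h1, Units.val_one, Matrix.one_mulVec, one_mul] at this
      exact left_eq_add.1 this
    rw [← hE]
    refine (mem_foldChain_iff hxE).2 ⟨?_, ?_⟩
    · have h3 := congrFun (h2 (Pi.single p.rev 1)) p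
      rw [Pi.smul_apply, smul_eq_mul, pairForm, Pi.single_eq_same, Pi.single_eq_of_ne
        (rev_ne n p).symm, mul_one, mul_zero, sub_zero, Pi.zero_apply] at h3
      exact mul_self_eq_zero.1 h3
    · have h3 := congrFun (h2 (Pi.single p 1)) p.rev
      rw [Pi.smul_apply, smul_eq_mul, pairForm, Pi.single_eq_same, Pi.single_eq_of_ne
        (rev_ne n p), mul_one, mul_zero, zero_sub, Pi.zero_apply, neg_mul, neg_eq_zero] at h3
      exact mul_self_eq_zero.1 h3
  · rw [hentry, Pi.single_eq_of_ne (by rintro rfl; exact hjl rfl), zero_add]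
    by_cases hj : fold n j = fold n p
    · have hl : fold n p ≠ fold n l := fun h => hjl (hj.trans h)
      have h1 : p ≠ l := by rintro rfl; exact hl rfl
      have h2 : p.rev ≠ l := by rintro rfl; exact hl (fold_rev n p).symm
      rw [pairForm, Pi.single_eq_of_ne h1, Pi.single_eq_of_ne h2]
      ring
    · simp only [x, if_neg hj, mul_zero]

end Flag

/-- The element d = g θ(g)⁻¹ is block diagonal with θ(d) = d⁻¹, so d ∈ S₀ ≤ Q and θ(g) = d⁻¹ g lies
in Q. -/
theorem mem_map_theta_of_blockDiagonal [CharZero K] {Q : Subgroup (GL (Fin (2 * n)) K)}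
    (hS : S₀ n K ≤ Q) {g : GL (Fin (2 * n)) K} (hg : g ∈ Q)
    (hblock : ∀ i j, fold n i ≠ fold n j → g.1 i j = 0) : g ∈ Q.map (theta n K) := by
  rw [mem_map_theta]
  have hL := (mem_P₀_inf_map_theta n).2 hblock
  have hθL : theta n K g ∈ P₀ n K ⊓ (P₀ n K).map (theta n K) :=
    ⟨(mem_map_theta n).1 hL.2, ⟨g, hL.1, rfl⟩⟩
  have hd : g * (theta n K g)⁻¹ ∈ S₀ n K := by
    refine mem_S₀_of_theta_eq_inv n
      ((mem_P₀_inf_map_theta n).1 (mul_mem hL (inv_mem hθL))) ?_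
    rw [map_mul, map_inv, theta_theta, _root_.mul_inv_rev, inv_inv]
  have h1 := mul_mem (inv_mem (hS hd)) hg
  rwa [_root_.mul_inv_rev, inv_inv, inv_mul_cancel_right] at h1

theorem minimal_isThetaSplitParabolic_P₀ (k : Type*) [Field k] [Algebra k K] [IsAlgClosed K]
    [CharZero K] : Minimal (IsThetaSplitParabolic k (theta n K)) (P₀ n K) := by
  refine ⟨isThetaSplitParabolic_P₀ n k, fun Q hQ hle => ?_⟩
  rw [P₀_eq_stabChain] at hle ⊢
  obtain ⟨⟨-, B, hB, hBQ⟩, hopp, -⟩ := hQ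
  obtain ⟨W, hW, hWB⟩ := hB.exists_fullFlag
  have hWQ := hWB.trans hBQ
  have hE := foldChain_eq_of_isFullFlag n hW (hWQ.trans hle)
  refine stabChain_foldChain_le_of_moves hW hE hle hWQ fun p => ?_
  -- A line preserved by Q would yield τ ≠ 1 in both Q ∩ θ(Q) and the unipotent radical of Q.
  by_contra! hfix
  obtain ⟨τ, hτQ, hτR, hτ1, hτ⟩ := exists_unipotentRadical_blockDiagonal hW hE hle hWQ hfix
  have hτθ := mem_map_theta_of_blockDiagonal ((S₀_le_stabChain hW hE).trans hWQ) hτQ hτ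
  have h : τ ∈ (Q ⊓ Q.map (theta n K)) ⊓ unipotentRadical Q := ⟨⟨hτQ, hτθ⟩, hτR⟩
  rw [hopp.2.1, Subgroup.mem_bot] at h
  exact hτ1 h

end Minimality

end SympSym

theorem mainTheorem6
    {F : Type*} [Field F] [CharZero F] [ValuativeRel F] [TopologicalSpace F]
    [IsNonarchimedeanLocalField F] (hF : Odd (ringChar 𝓀[F]))
    {K : Type*} [Field K] [Algebra F K] [IsAlgClosure F K]
    (n : ℕ) (hn : 2 ≤ n) :
    -- `A₀` is a maximal `F`-split torus, and it is `θ`-stable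
    Maximal (IsSplitTorus F) (A₀ n K) ∧
    (A₀ n K).map (theta n K) = A₀ n K ∧
    -- `A₀` contains `S₀`, which is a maximal `(θ, F)`-split torus
    S₀ n K ≤ A₀ n K ∧
    Maximal (IsThetaSplitTorus F (theta n K)) (S₀ n K) ∧
    -- `P₀` is a minimal `θ`-split parabolic subgroup
    Minimal (IsThetaSplitParabolic F (theta n K)) (P₀ n K) ∧
    -- the groups of `F`-points of `A₀`, `S₀`, `P₀` are the ones given by the same formulas over `F`
    rationalPoints F (A₀ n K) = A₀ n F ∧
    rationalPoints F (S₀ n K) = S₀ n F ∧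
    rationalPoints F (P₀ n K) = P₀ n F := by
  have : IsAlgClosed K := IsAlgClosure.isAlgClosed F
  have : CharZero K := charZero_of_injective_algebraMap (algebraMap F K).injective
  exact ⟨maximal_isSplitTorus_diagonalSubgroup F (2 * n), map_theta_A₀ n, S₀_le_A₀ n,
    maximal_isThetaSplitTorus_S₀ n F, minimal_isThetaSplitParabolic_P₀ F, rationalPoints_A₀ n F,
    rationalPoints_S₀ n F, rationalPoints_P₀ n F⟩
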